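/- Let $n\ge 3$ be finite. Write $L_{BA}=\{0,1,-,+\}$, $L_{\mathrm{Df}_n}=L_{BA}\cup\{c_i\mid i<n\}$ and $L_{\mathrm{PEA}_n}=L_{BA}\cup\{c_i,d_{ij},s_\sigma\mid i,j<n,\ \sigma:n\to n\}$, where the $c_i,s_\sigma$ are unary function symbols and the $d_{ij}$ are constants. Let $L$ be any signature with $L_{\mathrm{Df}_n}\subseteq L\subseteq L_{\mathrm{PEA}_n}$. An *$L$-atom structure* is a structure $\mathcal S$, with domain $S$, for the relational signature $L_+$ that has a $(k+1)$-ary relation symbol $R_f$ for each $k$-ary symbol $f\in L\setminus L_{BA}$. Its *complex algebra* $\mathcal S^+$ is the $L$-algebra on $\wp(S)$ in which the symbols of $L_{BA}$ have their natural boolean meaning and $f(X_1,\dots,X_k)=\{s\in S\mid R_f(x_1,\dots,x_k,s)\text{ for some }x_1\in X_1,\dots,x_k\in X_k\}$ for each $k$-ary $f\in L\setminus L_{BA}$. The *polyadic equality set algebra* on a non-empty set $U$ is the boolean algebra $\wp({}^nU)$ with $c_iX=\{x\mid \exists y\in X\ \forall j\ne i\ (y_j=x_j)\}$, $d_{ij}=\{x\mid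 x_i=x_j\}$ and $s_\sigma X=\{x\mid x\circ\sigma\in X\}$. A *diagonal-free cylindric set algebra* is $\wp(\prod_{i<n}U_i)$, for non-empty sets $U_0,\dots,U_{n-1}$, with the boolean operations and the $c_i$ defined by the same formula. Let $\mathsf{RL}$ be the class of $L$-algebras isomorphic to a subalgebra of a product of diagonal-free cylindric set algebras, if $L=L_{\mathrm{Df}_n}$, and of $L$-reducts of polyadic equality set algebras, otherwise. An $L$-atom structure $\mathcal S$ is *strongly representable* if $\mathcal S^+\in\mathsf{RL}$. **Theorem.** The class of strongly representable $L$-atom structures is not elementary: there is no first-order $L_+$-theory $T$ such that, for every non-empty $L$-atom structure $\mathcal S$, $\mathcal S$ is strongly representable if and only if $\mathcal S\models T$. -/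

import Mathlib

open FirstOrder FirstOrder.Language

universe u

namespace PolyadicAlg

/-- The function symbols of the signature of `n`-dimensional polyadic equality algebras, by arity:
the boolean symbols `0`, `1`, `-`, `+`, the cylindrifications `c_i`, the diagonals `d_ij`, and the
substitutions `s_σ` for all maps `σ : n → n`. -/
inductive PEAFunc (n : ℕ) : ℕ → Type
  | zero : PEAFunc n 0
  | one : PEAFunc n 0
  | neg : PEAFunc n 1
  | add : PEAFunc n 2
  | cyl (i : Fin n) : PEAFunc n 1
  | diag (i j : Fin n) : PEAFunc n 0
  | subst (σ : Fin n → Fin n) : PEAFunc n 1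

/-- A sub-signature of the signature of polyadic equality algebras: for each arity, the set of
function symbols of that arity that belong to it. Inclusion of signatures is `≤`. -/
abbrev Signature (n : ℕ) : Type := ∀ k : ℕ, Set (PEAFunc n k)

/-- The boolean symbols. -/
def PEAFunc.IsBoolean {n k : ℕ} : PEAFunc n k → Prop
  | .zero | .one | .neg | .add => True
  | .cyl _ | .diag _ _ | .subst _ => False

/-- The symbols of diagonal-free cylindric algebras. -/
def PEAFunc.IsDf {n k : ℕ} : PEAFunc n k → Prop
  | .zero | .one | .neg | .add | .cyl _ => True
  | .diag _ _ | .subst _ => False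

/-- The signature of boolean algebras. -/
def LBA (n : ℕ) : Signature n := fun _ => {f | f.IsBoolean}

/-- The signature of `n`-dimensional diagonal-free cylindric algebras. -/
def LDf (n : ℕ) : Signature n := fun _ => {f | f.IsDf}

/-- The signature of `n`-dimensional polyadic equality algebras. -/
def LPEA (n : ℕ) : Signature n := fun _ => Set.univ

/-- A signature as a first-order language without relation symbols. `L`-algebras are
structures for this language. -/
def Signature.lang {n : ℕ} (L : Signature n) : FirstOrder.Language.{0, 0} where
  Functions k := {f : PEAFunc n k // f ∈ L k}
  Relations _ := Empty

/-- The relation symbols of `L_+`, by arity: a `(k + 1)`-ary symbol `R_f` for each `k`-ary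
non-boolean function symbol `f` of `L`. -/
def Signature.AtomRel {n : ℕ} (L : Signature n) : ℕ → Type
  | 0 => Empty
  | k + 1 => {f : PEAFunc n k // f ∈ L k ∧ f ∉ LBA n k}

/-- The relational language `L_+`. An `L`-atom structure is a structure for this language. -/
def Signature.atomLang {n : ℕ} (L : Signature n) : FirstOrder.Language.{0, 0} where
  Functions _ := Empty
  Relations := L.AtomRel

/-- The relation symbol `R_f`. -/
def Signature.R {n : ℕ} {L : Signature n} {k : ℕ} (f : PEAFunc n k) (hf : f ∈ L k)
    (hb : f ∉ LBA n k) : L.atomLang.Relations (k + 1) :=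
  (⟨f, hf, hb⟩ : {f : PEAFunc n k // f ∈ L k ∧ f ∉ LBA n k})

/-- The operation on `℘(S)` given by a `(k + 1)`-ary relation symbol `R` of `L_+`:
`(X_1, …, X_k) ↦ {s | R(x_1, …, x_k, s) for some x_1 ∈ X_1, …, x_k ∈ X_k}`. -/
def complexOp {n : ℕ} {L : Signature n} {S : Type u} [L.atomLang.Structure S] {k : ℕ}
    (R : L.atomLang.Relations (k + 1)) (X : Fin k → Set S) : Set S :=
  {s | ∃ x : Fin k → S, (∀ i, x i ∈ X i) ∧ Structure.RelMap R (Fin.snoc x s : Fin (k + 1) → S)}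

/-- The operations of the complex algebra of an `L`-atom structure `S`. -/
def complexInterp {n : ℕ} {L : Signature n} {S : Type u} [L.atomLang.Structure S] :
    {k : ℕ} → (f : PEAFunc n k) → f ∈ L k → (Fin k → Set S) → Set S
  | _, .zero, _, _ => ∅
  | _, .one, _, _ => Set.univ
  | _, .neg, _, X => (X 0)ᶜ
  | _, .add, _, X => X 0 ∪ X 1
  | _, .cyl i, h, X => complexOp (Signature.R (.cyl i) h id) X
  | _, .diag i j, h, X => complexOp (Signature.R (.diag i j) h id) X
  | _, .subst σ, h, X => complexOp (Signature.R (.subst σ) h id) X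

/-- The domain `℘(S)` of the complex algebra `S⁺` of an `L`-atom structure `S`. -/
def ComplexAlgebra {n : ℕ} (_L : Signature n) (S : Type u) : Type u := Set S

/-- The complex algebra `S⁺` of an `L`-atom structure `S`. -/
instance complexAlgebraStructure {n : ℕ} (L : Signature n) (S : Type u)
    [L.atomLang.Structure S] : L.lang.Structure (ComplexAlgebra L S) where
  funMap f X := complexInterp (S := S) f.1 f.2 X
  RelMap r := nomatch r

/-- The operations of the polyadic equality set algebra on `U`. -/
def setInterp {n : ℕ} {U : Type u} :
    {k : ℕ} → PEAFunc n k → (Fin k → Set (Fin n → U)) → Set (Fin n → U)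
  | _, .zero, _ => ∅
  | _, .one, _ => Set.univ
  | _, .neg, X => (X 0)ᶜ
  | _, .add, X => X 0 ∪ X 1
  | _, .cyl i, X => {x | ∃ y ∈ X 0, ∀ j, j ≠ i → y j = x j}
  | _, .diag i j, _ => {x | x i = x j}
  | _, .subst σ, X => {x | x ∘ σ ∈ X 0}

/-- The domain `℘(ⁿU)` of the polyadic equality set algebra on `U`. -/
def SetAlgebra {n : ℕ} (_L : Signature n) (U : Type u) : Type u := Set (Fin n → U)

/-- The reduct to the signature `L` of the polyadic equality set algebra on `U`. -/
instance setAlgebraStructure {n : ℕ} (L : Signature n) (U : Type u) :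
    L.lang.Structure (SetAlgebra L U) where
  funMap f X := setInterp (U := U) f.1 X
  RelMap r := nomatch r

/-- The operations of the diagonal-free cylindric set algebra on `U_0, …, U_{n-1}`. -/
def dfSetInterp {n : ℕ} {U : Fin n → Type u} :
    {k : ℕ} → (f : PEAFunc n k) → f ∈ LDf n k → (Fin k → Set (∀ i, U i)) → Set (∀ i, U i)
  | _, .zero, _, _ => ∅
  | _, .one, _, _ => Set.univ
  | _, .neg, _, X => (X 0)ᶜ
  | _, .add, _, X => X 0 ∪ X 1
  | _, .cyl i, _, X => {x | ∃ y ∈ X 0, ∀ j, j ≠ i → y j = x j}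

/-- The domain `℘(∏ U_i)` of the diagonal-free cylindric set algebra on `U_0, …, U_{n-1}`. -/
def DfSetAlgebra {n : ℕ} {L : Signature n} (_hL : L ≤ LDf n) (U : Fin n → Type u) : Type u :=
  Set (∀ i, U i)

/-- The diagonal-free cylindric set algebra on `U_0, …, U_{n-1}`. -/
instance dfSetAlgebraStructure {n : ℕ} {L : Signature n} (hL : L ≤ LDf n) (U : Fin n → Type u) :
    L.lang.Structure (DfSetAlgebra hL U) where
  funMap f X := dfSetInterp (U := U) f.1 (hL _ f.2) X
  RelMap r := nomatch r

/-- The direct product of a family of algebras, with coordinatewise operations. -/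
instance productStructure {n : ℕ} (L : Signature n) {I : Type u} (B : I → Type u)
    [∀ t, L.lang.Structure (B t)] : L.lang.Structure (∀ t, B t) where
  funMap f X := fun t => Structure.funMap f fun m => X m t
  RelMap r := nomatch r

/-- The class `RL` of representable `L`-algebras: those that embed in (equivalently, are isomorphic
to a subalgebra of) a product of set algebras of signature `L`. When `L` has no symbol beyond those
of diagonal-free cylindric algebras, the set algebras are the diagonal-free cylindric set
algebras, with units `∏ U_i`; otherwise they are the `L`-reducts of polyadic
equality set algebras, with units `ⁿU`. -/
def IsRepresentable {n : ℕ} (L : Signature n) (A : Type u) [L.lang.Structure A] : Prop :=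
  (∃ (hL : L ≤ LDf n) (I : Type u) (U : I → Fin n → Type u), (∀ t i, Nonempty (U t i)) ∧
    Nonempty (A ↪[L.lang] (∀ t, DfSetAlgebra hL (U t)))) ∨
  (¬ L ≤ LDf n ∧ ∃ (I : Type u) (U : I → Type u), (∀ t, Nonempty (U t)) ∧
    Nonempty (A ↪[L.lang] (∀ t, SetAlgebra L (U t))))

/-- An `L`-atom structure is strongly representable if its complex algebra is in `RL`. -/
def IsStronglyRepresentable {n : ℕ} (L : Signature n) (S : Type u)
    [L.atomLang.Structure S] : Prop :=
  IsRepresentable L (ComplexAlgebra L S)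

/-- A class `K` of (nonempty) structures is elementary if it is the class of all models of some
first-order theory. -/
def IsElementaryClass (L : FirstOrder.Language.{0, 0}) (K : ∀ (M : Type u) [L.Structure M], Prop) : Prop :=
  ∃ T : L.Theory, ∀ (M : Type u) [L.Structure M] [Nonempty M], K M ↔ M ⊨ T

end PolyadicAlg

-- From a graph `G` one builds an atom structure whose complex algebra is representable if `G` has
-- infinite chromatic number, while an ultraproduct of such structures is not strongly representable
-- if the ultraproduct of the graphs is finitely colourable. The graphs are shift graphs with window
-- `m`. Each has infinite chromatic number, but in the ultraproduct an edge is a full shift of an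
-- injective sequence, and parity gives a proper 2-colouring. By Łoś, a theory defining strong
-- representability would hold in the ultraproduct, a contradiction.
--
-- Atoms are patterns of `n`-tuples: the equalities between entries, and colours of the sets of `n -
-- 1` distinct entries, such that an injective tuple has two facets with adjacent colours. Colours
-- are vertices of finitely many copies of `G`, different copies being fully joined.
--
-- Sufficiency (`isStronglyRepresentable_patternAtom`). Infinite chromatic number yields an
-- ultrafilter `μ` on the vertices with no independent member. The base consists of formal points,
-- each recording a tuple, a position and an ultrafilter of patterns to be realised there. A facet
-- lying in the tuple that created its last point gets its colour from the recorded ultrafilter; any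
-- other facet gets the colour `μ`, in a copy not used by its last point. `exists_adj_facetColour`
-- shows that `n` points never before joined have two facets whose ultrafilters cannot be separated
-- by non-adjacency, so a joint distribution exists. A tuple satisfies a set of atoms if the set
-- belongs to its ultrafilter of patterns, and `exists_realisation` gives the cylindrifications.
--
-- Necessity (`FacetColouring.not_isRealisation`). One factor of a representation assigns an
-- ultrafilter of the complex algebra to every point. The sets of atoms playing the role of
-- diagonals are elements of the algebra even when the signature has no diagonals; constant points
-- then replace the elements of a common base, and infinitely many colours provide infinitely many
-- distinct ones. A division of the colours into finitely many classes induces a colouring of `(n -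
-- 1)`-tuples of these. A Ramsey argument, by an iterated ultrafilter, gives an injective `n`-tuple
-- all of whose facets are in one class, which no atom permits.

universe v w

namespace PolyadicAlg

/-! ### Shift graphs and their colourings -/

/-- The type of strictly increasing sequences of natural numbers. -/
abbrev IncSeq : Type := {x : ℕ → ℕ // StrictMono x}

/-- The edge relation of the shift graph with window `m` on increasing sequences. -/
def shiftRel (m : ℕ) (x y : IncSeq) : Prop := x.1 0 < y.1 0 ∧ ∀ j < m, y.1 j = x.1 (j + 1)

/-- The sequence `a, x 0, x 1, …`. -/
def IncSeq.cons (a : ℕ) (x : IncSeq) (h : a < x.1 0) : IncSeq :=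
  ⟨fun j => Nat.casesOn j a x.1, by
    refine strictMono_nat_of_lt_succ fun j => ?_
    cases j with
    | zero => exact h
    | succ j => exact x.2 (Nat.lt_succ_self j)⟩

/-- The shift graphs are not finitely colourable. -/
theorem exists_shiftRel_eq (m : ℕ) {α : Type v} [Finite α] (f : IncSeq → α) :
    ∃ x y, shiftRel m x y ∧ f x = f y := by
  induction m generalizing α with
  | zero =>
    have hmono : ∀ k : ℕ, StrictMono fun j : ℕ => k + j := fun k a b h => by
      simpa using h
    obtain ⟨a, b, hab, h⟩ := Finite.exists_ne_map_eq_of_infinite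
      fun k : ℕ => f ⟨fun j => k + j, hmono k⟩
    rcases lt_or_gt_of_ne hab with hlt | hlt
    · exact ⟨_, _, ⟨by simpa using hlt, by simp⟩, h⟩
    · exact ⟨_, _, ⟨by simpa using hlt, by simp⟩, h.symm⟩
  | succ m ih =>
    -- Colour `x` by the set of colours that `f` takes on sequences with the same first `m + 1`
    -- entries. On an edge `x`, `y` with equal sets, `x 0` followed by `y` begins like `x`, so its
    -- colour recurs on some `e` that begins like `y`; this is the required edge.
    obtain ⟨x, y, ⟨h0, hxy⟩, hg⟩ := ih
      fun x : IncSeq => {a : α | ∃ x' : IncSeq, (∀ j < m + 1, x'.1 j = x.1 j) ∧ f x' = a}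
    have hmem : f (IncSeq.cons (x.1 0) y h0) ∈
        {a : α | ∃ x' : IncSeq, (∀ j < m + 1, x'.1 j = x.1 j) ∧ f x' = a} := by
      refine ⟨_, fun j hj => ?_, rfl⟩
      cases j with
      | zero => rfl
      | succ j => exact hxy j (by omega)
    rw [hg] at hmem
    obtain ⟨e, he, hfe⟩ := hmem
    refine ⟨_, e, ⟨?_, fun j hj => ?_⟩, hfe.symm⟩
    · rw [he 0 (by omega)]
      exact h0
    · rw [he j hj]
      rfl

/-- Injective sequences can be coloured by two colours such that no sequence has the colour of
its shift. -/
theorem exists_shift_colouring (Z : Type v) :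
    ∃ χ : (ℕ → Z) → Bool, ∀ a b : ℕ → Z, Function.Injective a →
      (∀ j, b j = a (j + 1)) → χ a ≠ χ b := by
  -- Tail equivalence: equality after dropping initial segments of possibly different lengths.
  let r : (ℕ → Z) → (ℕ → Z) → Prop := fun a b => ∃ p q, ∀ j, a (j + p) = b (j + q)
  have hr : Equivalence r := by
    refine ⟨fun a => ⟨0, 0, fun j => rfl⟩, fun {a b} ⟨p, q, h⟩ => ⟨q, p, fun j => (h j).symm⟩, ?_⟩
    rintro a b c ⟨p, q, h⟩ ⟨p', q', h'⟩
    refine ⟨p + p', q + q', fun j => ?_⟩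
    have h1 := h (j + p')
    have h2 := h' (j + q)
    rw [show j + (p + p') = j + p' + p by ring, h1, show j + p' + q = j + q + p' by ring, h2]
    congr 1
    ring
  let s : Setoid (ℕ → Z) := ⟨r, hr⟩
  let ρ : (ℕ → Z) → ℕ → Z := fun a => (Quotient.mk s a).out
  have hρ : ∀ a, r a (ρ a) := fun a => hr.symm (Quotient.exact (Quotient.out_eq (Quotient.mk s a)))
  choose p q hpq using hρ
  -- For injective `a` the offset `p a - q a` from the chosen representative is determined, and
  -- passing to the shift lowers it by one, so the parity of `p + q` changes.
  refine ⟨fun a => decide (Even (p a + q a)), fun a b ha hab => ?_⟩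
  have hb : Function.Injective b := fun i j h => by
    rw [hab, hab] at h
    simpa using ha h
  have hra : r a b := ⟨1, 0, fun j => (hab j).symm⟩
  have hEq : ρ a = ρ b := by
    change (Quotient.mk s a).out = (Quotient.mk s b).out
    rw [Quotient.sound (s := s) hra]
  have h3 : p a + q b = p b + 1 + q a := by
    have hinj : ∀ i j, ρ b (i + q b) = ρ b (j + q b) → i = j := fun i j h => by
      rw [← hpq b, ← hpq b] at h
      simpa using hb h
    by_contra hne
    have hz : ρ b (p b + 1 + q a + q b) = ρ b (p a + q b + q b) := by
      have e5 := hpq a (p b + 1 + q b)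
      have e6 := hpq b (p a + q b)
      rw [hab] at e6
      rw [hEq] at e5
      rw [show p b + 1 + q a + q b = p b + 1 + q b + q a by ring, ← e5, ← e6]
      congr 1
      ring
    exact hne (hinj _ _ hz).symm
  intro h
  rw [decide_eq_decide, Nat.even_iff, Nat.even_iff] at h
  omega

/-! ### Ultrafilters without independent members -/

/-- A relation has infinite chromatic number if every finite colouring has a monochromatic edge. -/
def InfiniteChromatic {X : Type u} (G : X → X → Prop) : Prop :=
  ∀ {α : Type u} [Finite α] (f : X → α), ∃ x y, G x y ∧ f x = f y

/-- If the chromatic number is infinite then there is an ultrafilter all of whose members contain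
an edge. -/
theorem InfiniteChromatic.exists_ultrafilter {X : Type u} {G : X → X → Prop}
    (hG : InfiniteChromatic G) : ∃ μ : Ultrafilter X, ∀ t ∈ μ, ∃ x ∈ t, ∃ y ∈ t, G x y := by
  let 𝓘 : Set (Set X) := {t | ∀ x ∈ tᶜ, ∀ y ∈ tᶜ, ¬ G x y}
  have hne : (Filter.generate 𝓘).NeBot := by
    rw [Filter.generate_neBot_iff]
    intro t ht hfin
    by_contra hem
    rw [Set.not_nonempty_iff_eq_empty] at hem
    -- An empty finite intersection means that finitely many independent sets cover `X`, which is a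
    -- proper finite colouring.
    have hcov : ∀ x, ∃ s : t, x ∉ s.1 := fun x => by
      have : x ∉ ⋂₀ t := by rw [hem]; simp
      simpa using this
    choose f hf using hcov
    have : Finite t := hfin
    obtain ⟨x, y, hxy, hf'⟩ := hG f
    exact ht (f x).2 x (hf x) y (hf' ▸ hf y) hxy
  refine ⟨Ultrafilter.of (Filter.generate 𝓘), fun t ht => ?_⟩
  by_contra hcon
  have : tᶜ ∈ Filter.generate 𝓘 := Filter.mem_generate_of_mem fun x hx y hy hxy =>
    hcon ⟨x, by simpa using hx, y, by simpa using hy, hxy⟩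
  exact Ultrafilter.compl_notMem_iff.2 ht (Ultrafilter.of_le _ this)

open scoped Classical

/-! ### Patterns of tuples -/

/-- A pattern records, for an `n`-tuple of points of a set some of whose finite subsets are
coloured, the equalities between its entries and the colours of the sets of entries. -/
@[ext]
structure Pattern (n : ℕ) (C : Type u) where
  rel : Setoid (Fin n)
  col : Finset (Fin n) → C

namespace Pattern

variable {n : ℕ} {C : Type u} {V : Type v}

/-- The pattern of `v ∘ σ`, where `s` is the pattern of `v`. -/
def subst (s : Pattern n C) (σ : Fin n → Fin n) : Pattern n C :=
  ⟨s.rel.comap σ, fun B => s.col (B.image σ)⟩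

/-- The part of the pattern that does not depend on the `i`-th entry. -/
def face (i : Fin n) (s : Pattern n C) : (Fin n → Fin n → Prop) × C :=
  (fun j k => j ≠ i ∧ k ≠ i ∧ s.rel j k, s.col {i}ᶜ)

/-- The image of a set of indices in the quotient. -/
noncomputable def classes (r : Setoid (Fin n)) (B : Finset (Fin n)) : Finset (Quotient r) :=
  B.image (Quotient.mk r)

/-- The pattern of a tuple in a set whose subsets with `n - 1` elements are coloured. -/
noncomputable def ofTuple (c₀ : C) (v : Fin n → V) (col : Finset V → C) : Pattern n C :=
  ⟨Setoid.ker v, fun B => if (B.image v).card = n - 1 then col (B.image v) else c₀⟩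

/-- The patterns of tuples such that the facets of an injective tuple are not independent. -/
structure Valid (Adj : C → C → Prop) (c₀ : C) (s : Pattern n C) : Prop where
  col_of_card : ∀ B, (classes s.rel B).card ≠ n - 1 → s.col B = c₀
  col_congr : ∀ B B', classes s.rel B = classes s.rel B' → s.col B = s.col B'
  adj : s.rel = ⊥ → ∃ i j, Adj (s.col {i}ᶜ) (s.col {j}ᶜ)

theorem classes_eq_iff {r : Setoid (Fin n)} {B B' : Finset (Fin n)} :
    classes r B = classes r B' ↔ (∀ b ∈ B, ∃ b' ∈ B', r b b') ∧ ∀ b' ∈ B', ∃ b ∈ B, r b b' := by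
  constructor
  · intro h
    constructor
    · intro b hb
      have : Quotient.mk r b ∈ classes r B' := h ▸ Finset.mem_image_of_mem _ hb
      obtain ⟨b', hb', e⟩ := Finset.mem_image.1 this
      exact ⟨b', hb', r.symm (Quotient.exact e)⟩
    · intro b hb
      have : Quotient.mk r b ∈ classes r B := h ▸ Finset.mem_image_of_mem _ hb
      obtain ⟨b', hb', e⟩ := Finset.mem_image.1 this
      exact ⟨b', hb', Quotient.exact e⟩
  · rintro ⟨h1, h2⟩
    ext q
    simp only [classes, Finset.mem_image]
    constructor
    · rintro ⟨b, hb, rfl⟩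
      obtain ⟨b', hb', e⟩ := h1 b hb
      exact ⟨b', hb', Quotient.sound (r.symm e)⟩
    · rintro ⟨b, hb, rfl⟩
      obtain ⟨b', hb', e⟩ := h2 b hb
      exact ⟨b', hb', Quotient.sound e⟩

theorem card_classes_ker (v : Fin n → V) (B : Finset (Fin n)) :
    (classes (Setoid.ker v) B).card = (B.image v).card := by
  have : B.image v = (classes (Setoid.ker v) B).image (Setoid.kerLift v) := by
    rw [classes, Finset.image_image]
    rfl
  rw [this, Finset.card_image_of_injective _ (Setoid.kerLift_injective v)]

theorem card_classes_comap (r : Setoid (Fin n)) (σ : Fin n → Fin n) (B : Finset (Fin n)) :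
    (classes (r.comap σ) B).card = (classes r (B.image σ)).card := by
  have h : r.comap σ = Setoid.ker (Quotient.mk r ∘ σ) := by
    ext a b
    exact (Quotient.eq (r := r)).symm
  rw [h, card_classes_ker, classes, Finset.image_image]
  congr!

theorem card_classes_le (r : Setoid (Fin n)) (B : Finset (Fin n)) :
    (classes r B).card ≤ B.card := Finset.card_image_le

theorem card_compl_singleton (i : Fin n) : ({i}ᶜ : Finset (Fin n)).card = n - 1 := by
  rw [Finset.card_compl, Finset.card_singleton, Fintype.card_fin]

theorem eq_compl_of_card {i : Fin n} {B : Finset (Fin n)} (hi : i ∉ B) (h : n - 1 ≤ B.card) :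
    B = {i}ᶜ := by
  refine Finset.eq_of_subset_of_card_le (fun j hj => ?_) (by rwa [card_compl_singleton])
  simp only [Finset.mem_compl, Finset.mem_singleton]
  rintro rfl
  exact hi hj

/-- The map that replaces `i` by `j`. -/
def repl (i j : Fin n) : Fin n → Fin n := Function.update id i j

theorem repl_self (i j : Fin n) : repl i j i = j := Function.update_self ..

theorem repl_of_ne {i j k : Fin n} (h : k ≠ i) : repl i j k = k := Function.update_of_ne h ..

theorem repl_ne {i j : Fin n} (h : j ≠ i) (k : Fin n) : repl i j k ≠ i := by
  by_cases hk : k = i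
  · rw [hk, repl_self]
    exact h
  · rwa [repl_of_ne hk]

theorem subst_id (s : Pattern n C) : s.subst id = s := by
  ext1
  · rfl
  · funext B
    simp [subst]

theorem ofTuple_comp (c₀ : C) (v : Fin n → V) (col : Finset V → C) (σ : Fin n → Fin n) :
    ofTuple c₀ (v ∘ σ) col = (ofTuple c₀ v col).subst σ := by
  ext1
  · rfl
  · funext B
    simp only [ofTuple, subst, Finset.image_image]

theorem face_subst_congr {s : Pattern n C} {σ τ : Fin n → Fin n} {i : Fin n}
    (h : ∀ j, j ≠ i → σ j = τ j) : face i (s.subst σ) = face i (s.subst τ) := by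
  refine Prod.ext ?_ ?_
  · funext j k
    refine propext (and_congr_right fun hj => and_congr_right fun hk => ?_)
    change s.rel (σ j) (σ k) ↔ s.rel (τ j) (τ k)
    rw [h j hj, h k hk]
  · change s.col _ = s.col _
    congr 1
    refine Finset.image_congr fun j hj => h j ?_
    simpa using hj

theorem face_subst_repl (s : Pattern n C) (i j : Fin n) : face i (s.subst (repl i j)) = face i s := by
  conv_rhs => rw [← subst_id s]
  exact face_subst_congr fun k hk => repl_of_ne hk

theorem Valid.ofTuple {Adj : C → C → Prop} {c₀ : C} {v : Fin n → V} {col : Finset V → C}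
    (h : Function.Injective v → ∃ i j, Adj (col (({i}ᶜ : Finset (Fin n)).image v))
      (col (({j}ᶜ : Finset (Fin n)).image v))) : (ofTuple c₀ v col).Valid Adj c₀ := by
  refine ⟨fun B hB => ?_, fun B B' hB => ?_, fun hr => ?_⟩
  · rw [Pattern.ofTuple, card_classes_ker] at hB
    exact if_neg hB
  · have : B.image v = B'.image v := by
      have e : ∀ B : Finset (Fin n),
          B.image v = (classes (Setoid.ker v) B).image (Setoid.kerLift v) := fun B => by
        rw [classes, Finset.image_image]
        rfl
      rw [e, e]
      exact congrArg _ hB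
    simp only [Pattern.ofTuple, this]
  · have hv : Function.Injective v := Setoid.injective_iff_ker_bot v |>.2 hr
    obtain ⟨i, j, hij⟩ := h hv
    have e : ∀ i : Fin n, (Pattern.ofTuple c₀ v col).col {i}ᶜ =
        col (({i}ᶜ : Finset (Fin n)).image v) := fun i => by
      refine if_pos ?_
      rw [Finset.card_image_of_injective _ hv, card_compl_singleton]
    exact ⟨i, j, by rwa [e, e]⟩

/-- The adjacency condition matters only if the new tuple is injective; then `σ` is a permutation,
and it permutes the facets. -/
theorem Valid.subst {Adj : C → C → Prop} {c₀ : C} {s : Pattern n C} (hs : s.Valid Adj c₀)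
    (σ : Fin n → Fin n) : (s.subst σ).Valid Adj c₀ := by
  refine ⟨fun B hB => ?_, fun B B' hB => ?_, fun hr => ?_⟩
  · refine hs.col_of_card _ ?_
    rwa [← card_classes_comap]
  · refine hs.col_congr _ _ ?_
    rw [classes_eq_iff] at hB ⊢
    obtain ⟨h1, h2⟩ := hB
    simp only [Finset.mem_image, forall_exists_index, and_imp, forall_apply_eq_imp_iff₂,
      exists_exists_and_eq_and]
    exact ⟨h1, h2⟩
  · have hσ : Function.Injective σ := fun a b hab => by
      have : (s.rel.comap σ) a b := by
        rw [Setoid.comap_rel, hab]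
      have h' : (⊥ : Setoid (Fin n)) a b := hr ▸ this
      exact h'
    have hσ' : Function.Surjective σ := Finite.surjective_of_injective hσ
    have hbot : s.rel = ⊥ := by
      refine eq_bot_iff.2 fun a b hab => ?_
      obtain ⟨a, rfl⟩ := hσ' a
      obtain ⟨b, rfl⟩ := hσ' b
      have : (s.subst σ).rel a b := hab
      rw [hr] at this
      exact congrArg σ this
    have himg : ∀ i, ({i}ᶜ : Finset (Fin n)).image σ = {σ i}ᶜ := fun i => by
      refine eq_compl_of_card ?_ ?_
      · simp only [Finset.mem_image, Finset.mem_compl, Finset.mem_singleton, not_exists, not_and]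
        exact fun j hj e => hj (hσ e)
      · rw [Finset.card_image_of_injective _ hσ, card_compl_singleton]
    obtain ⟨i, j, hij⟩ := hs.adj hbot
    obtain ⟨i, rfl⟩ := hσ' i
    obtain ⟨j, rfl⟩ := hσ' j
    refine ⟨i, j, ?_⟩
    change Adj (s.col _) (s.col _)
    rwa [himg, himg]

theorem Valid.subst_repl_of_rel {Adj : C → C → Prop} {c₀ : C} {s : Pattern n C}
    (hs : s.Valid Adj c₀) {i j : Fin n} (h : s.rel i j) : s.subst (repl i j) = s := by
  have hr : ∀ k, s.rel (repl i j k) k := fun k => by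
    by_cases hk : k = i
    · rw [hk, repl_self]
      exact s.rel.symm h
    · rw [repl_of_ne hk]
  ext1
  · ext a b
    constructor
    · intro hab
      exact s.rel.trans (s.rel.symm (hr a)) (s.rel.trans hab (hr b))
    · intro hab
      exact s.rel.trans (hr a) (s.rel.trans hab (s.rel.symm (hr b)))
  · funext B
    refine hs.col_congr _ _ ?_
    rw [classes_eq_iff]
    simp only [Finset.mem_image, forall_exists_index, and_imp, forall_apply_eq_imp_iff₂,
      exists_exists_and_eq_and]
    exact ⟨fun b hb => ⟨b, hb, hr b⟩, fun b hb => ⟨b, hb, hr b⟩⟩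

/-- The image of `repl i j` misses `i`, so the only set of indices that can carry a colour other
than `c₀` is `{i}ᶜ`, and its colour is part of the face. -/
theorem Valid.subst_repl_congr {Adj : C → C → Prop} {c₀ : C} {s t : Pattern n C}
    (hs : s.Valid Adj c₀) (ht : t.Valid Adj c₀) {i j : Fin n} (hj : j ≠ i)
    (h : face i s = face i t) : s.subst (repl i j) = t.subst (repl i j) := by
  have hrel : ∀ a b, a ≠ i → b ≠ i → (s.rel a b ↔ t.rel a b) := fun a b ha hb => by
    have := congrFun (congrFun (congrArg Prod.fst h) a) b
    simpa [face, ha, hb] using this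
  ext1
  · ext a b
    exact hrel _ _ (repl_ne hj a) (repl_ne hj b)
  · funext B
    change s.col _ = t.col _
    have hi : i ∉ B.image (repl i j) := by
      simp only [Finset.mem_image, not_exists, not_and]
      exact fun k _ => repl_ne hj k
    by_cases hB : n - 1 ≤ (B.image (repl i j)).card
    · rw [eq_compl_of_card hi hB]
      exact congrArg Prod.snd h
    · rw [hs.col_of_card, ht.col_of_card]
      · exact fun h => hB (h ▸ card_classes_le _ _)
      · exact fun h => hB (h ▸ card_classes_le _ _)

end Pattern

/-! ### Joint ultrafilters and colours -/

/-- Prescribed ultrafilters on the coordinates of a power can be realised jointly. If any members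
of two of them are joined by an edge then those coordinates can be made adjacent. -/
theorem exists_joint_ultrafilter {ι : Type u} {C : Type v} (ν : ι → Ultrafilter C)
    (R : (ι → C) → Prop)
    (hR : ∀ t : ι → Set C, (∀ i, t i ∈ ν i) → ∃ K, (∀ i, K i ∈ t i) ∧ R K) :
    ∃ U : Ultrafilter (ι → C), (∀ i, U.map (fun K => K i) = ν i) ∧ ∀ᶠ K in (U : Filter (ι → C)), R K := by
  let Φ : Filter (ι → C) := Filter.pi (fun i => (ν i : Filter C)) ⊓ Filter.principal {K | R K}
  have hΦ : Φ.NeBot := by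
    rw [Filter.inf_principal_neBot_iff]
    intro s hs
    obtain ⟨I, hI, t, ht, hts⟩ := Filter.mem_pi.1 hs
    obtain ⟨K, hK, hRK⟩ := hR t ht
    exact ⟨K, hts fun i _ => hK i, hRK⟩
  refine ⟨Ultrafilter.of Φ, fun i => ?_, ?_⟩
  · refine Ultrafilter.coe_le_coe.1 ?_
    have : Filter.Tendsto (fun K : ι → C => K i) (Ultrafilter.of Φ) (ν i) :=
      (Filter.tendsto_eval_pi (fun i => (ν i : Filter C)) i).mono_left
        ((Ultrafilter.of_le Φ).trans inf_le_left)
    exact this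
  · exact Ultrafilter.of_le Φ (Filter.mem_inf_of_right (Filter.mem_principal_self _))

/-- The colours: copies of the vertices of a graph, one for every element of a finite set that is
larger than the set of sets of indices. -/
abbrev Colour (n : ℕ) (X : Type u) : Type u := X × Option (Finset (Fin n))

/-- Colours are adjacent if they lie in different copies, or are adjacent in the graph. -/
def colourAdj {n : ℕ} {X : Type u} (G : X → X → Prop) (p q : Colour n X) : Prop :=
  p.2 ≠ q.2 ∨ G p.1 q.1

/-! ### Formal points, ordered by depth -/

/-- The potential points of a representation: a root, and points that are added to a tuple in place
of one of its entries with prescribed data. -/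
inductive Point (n : ℕ) (D : Type u) : Type u
  | root : Point n D
  | ext (i : Fin n) (v : Fin n → Point n D) (F : D) : Point n D

namespace Point

variable {n : ℕ} {D : Type u}

/-- The depth of a point. -/
def depth : Point n D → ℕ
  | root => 0
  | ext _ v _ => (Finset.univ.sup fun j => depth (v j)) + 1

theorem depth_lt (i : Fin n) (v : Fin n → Point n D) (F : D) (j : Fin n) :
    (v j).depth < (ext i v F).depth :=
  Nat.lt_succ_of_le (Finset.le_sup (f := fun j => (v j).depth) (Finset.mem_univ j))

theorem ext_ne (i : Fin n) (v : Fin n → Point n D) (F : D) (j : Fin n) : ext i v F ≠ v j :=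
  fun h => (depth_lt i v F j).ne (congrArg depth h).symm

/-- An injection of the points in a linear order, monotone with respect to the depth. -/
noncomputable def key (z : Point n D) : ℕ ×ₗ Cardinal.{u} := toLex (z.depth, embeddingToCardinal z)

theorem key_injective : Function.Injective (key : Point n D → ℕ ×ₗ Cardinal.{u}) := fun _ _ h =>
  embeddingToCardinal.injective (congrArg Prod.snd (toLex.injective h))

theorem key_lt_of_depth_lt {x y : Point n D} (h : x.depth < y.depth) : x.key < y.key :=
  Prod.Lex.toLex_lt_toLex.2 (Or.inl h)

/-- `t` is the last element of `A`. -/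
def IsTop (A : Finset (Point n D)) (t : Point n D) : Prop := t ∈ A ∧ ∀ b ∈ A, b.key ≤ t.key

theorem IsTop.unique {A : Finset (Point n D)} {t t' : Point n D} (h : IsTop A t)
    (h' : IsTop A t') : t = t' :=
  key_injective (le_antisymm (h'.2 _ h.1) (h.2 _ h'.1))

theorem exists_isTop {A : Finset (Point n D)} (hA : A.Nonempty) : ∃ t, IsTop A t := by
  obtain ⟨t, ht, h⟩ := Finset.exists_max_image A key hA
  exact ⟨t, ht, h⟩

/-- The tuple to which a point has been added. -/
noncomputable def tuple (i : Fin n) (v : Fin n → Point n D) (F : D) : Fin n → Point n D :=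
  Function.update v i (ext i v F)

theorem tuple_self (i : Fin n) (v : Fin n → Point n D) (F : D) : tuple i v F i = ext i v F :=
  Function.update_self ..

theorem tuple_of_ne {i j : Fin n} (h : j ≠ i) (v : Fin n → Point n D) (F : D) :
    tuple i v F j = v j := Function.update_of_ne h ..

/-- The set `A` consists of the point `ext i v F` and some of the entries of `v` other than
the `i`-th. -/
def IsApex (A : Finset (Point n D)) (p : Fin n × (Fin n → Point n D) × D) : Prop :=
  ext p.1 p.2.1 p.2.2 ∈ A ∧ A.erase (ext p.1 p.2.1 p.2.2) ⊆ ({p.1}ᶜ : Finset (Fin n)).image p.2.1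

/-- A new point is deeper than the entries of its tuple, and `key` compares depths first.
Consequently a set has at most one apex. -/
theorem IsApex.isTop {A : Finset (Point n D)} {p : Fin n × (Fin n → Point n D) × D}
    (h : IsApex A p) : IsTop A (ext p.1 p.2.1 p.2.2) := by
  refine ⟨h.1, fun b hb => ?_⟩
  by_cases e : b = ext p.1 p.2.1 p.2.2
  · rw [e]
  · obtain ⟨j, -, rfl⟩ := Finset.mem_image.1 (h.2 (Finset.mem_erase.2 ⟨e, hb⟩))
    exact (key_lt_of_depth_lt (depth_lt _ _ _ _)).le

theorem IsApex.unique {A : Finset (Point n D)} {p q : Fin n × (Fin n → Point n D) × D}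
    (h : IsApex A p) (h' : IsApex A q) : p = q := by
  have := h.isTop.unique h'.isTop
  injection this with h1 h2 h3
  exact Prod.ext h1 (Prod.ext h2 h3)

theorem IsApex.mono {A B : Finset (Point n D)} {p : Fin n × (Fin n → Point n D) × D}
    (h : IsApex A p) (hB : B ⊆ A) (hp : ext p.1 p.2.1 p.2.2 ∈ B) : IsApex B p :=
  ⟨hp, (Finset.erase_subset_erase _ hB).trans h.2⟩

theorem IsApex.eq_image {A : Finset (Point n D)} {p : Fin n × (Fin n → Point n D) × D}
    (h : IsApex A p) (hA : A.card = n) :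
    A.erase (ext p.1 p.2.1 p.2.2) = ({p.1}ᶜ : Finset (Fin n)).image p.2.1 := by
  refine Finset.eq_of_subset_of_card_le h.2 ?_
  rw [Finset.card_erase_of_mem h.1, hA, ← Pattern.card_compl_singleton p.1]
  exact Finset.card_image_le

end Point

/-! ### Ultrafilters as colours of facets -/

section Labels

variable {n : ℕ} {X : Type u}

/-- The points of the representation carry ultrafilters on the patterns. -/
abbrev PPoint (n : ℕ) (X : Type u) : Type u := Point n (Ultrafilter (Pattern n (Colour n X)))

open Point

theorem exists_copy (ν : Ultrafilter (Colour n X)) : ∃ a, ∀ᶠ c in (ν : Filter (Colour n X)), c.2 = a := by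
  obtain ⟨a, ha⟩ := Ultrafilter.eq_pure_of_finite (ν.map Prod.snd)
  refine ⟨a, ?_⟩
  have : ({a} : Set _) ∈ ν.map Prod.snd := by
    rw [ha]
    exact Set.mem_singleton a
  exact this

/-- The ultrafilter settles on one copy for each of the `2 ^ n` sets of indices, and there are `2 ^
n + 1` copies. -/
theorem exists_avoid (F : Ultrafilter (Pattern n (Colour n X))) :
    ∃ a, ∀ B, ∀ᶠ s in (F : Filter (Pattern n (Colour n X))), (s.col B).2 ≠ a := by
  choose f hf using fun B : Finset (Fin n) => exists_copy (F.map fun s => s.col B)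
  have hsurj : ¬ Function.Surjective f := fun hs => by
    have := Fintype.card_le_of_surjective f hs
    simp at this
  obtain ⟨a, ha⟩ := not_forall.1 hsurj
  refine ⟨a, fun B => ?_⟩
  have h : ∀ᶠ s in (F : Filter (Pattern n (Colour n X))), (s.col B).2 = f B := hf B
  filter_upwards [h] with s hs e
  exact ha ⟨B, hs.symm.trans e⟩

/-- The last element of `A` is unique, so at most one ultrafilter has to be avoided. -/
theorem exists_genericCopy (A : Finset (PPoint n X)) :
    ∃ a : Option (Finset (Fin n)), ∀ i v F, IsTop A (ext i v F) → ∀ B, ∀ᶠ s in (F : Filter (Pattern n (Colour n X))), (s.col B).2 ≠ a := by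
  by_cases h : ∃ p : Fin n × (Fin n → PPoint n X) × Ultrafilter (Pattern n (Colour n X)),
    IsTop A (ext p.1 p.2.1 p.2.2)
  · obtain ⟨p, hp⟩ := h
    obtain ⟨a, ha⟩ := exists_avoid p.2.2
    refine ⟨a, fun i v F h => ?_⟩
    have := h.unique hp
    injection this with _ _ h3
    rw [h3]
    exact ha
  · exact ⟨none, fun i v F hF => absurd ⟨(i, v, F), hF⟩ h⟩

/-- The copy in which the colour of a facet is chosen when it is not prescribed. -/
noncomputable def genericCopy (A : Finset (PPoint n X)) : Option (Finset (Fin n)) :=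
  (exists_genericCopy A).choose

/-- The colouring of sets of points induced by a pattern of the tuple of an added point. -/
noncomputable def liftCol (p : Fin n × (Fin n → PPoint n X) × Ultrafilter (Pattern n (Colour n X)))
    (s : Pattern n (Colour n X)) (B : Finset (PPoint n X)) : Colour n X :=
  s.col (Finset.univ.filter fun j => tuple p.1 p.2.1 p.2.2 j ∈ B)

variable (μ : Ultrafilter X) (G : X → X → Prop) (c₀ : Colour n X)

/-- The colour, as an ultrafilter, of a set of `n - 1` points. -/
noncomputable def facetColour (A : Finset (PPoint n X)) : Ultrafilter (Colour n X) :=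
  if h : ∃ p, IsApex A p then h.choose.2.2.map fun s => liftCol h.choose s A
  else μ.map fun x => (x, genericCopy A)

/-- `U` is a joint distribution of the colours of facets that is admissible for `A`. -/
def IsJoint (A : Finset (PPoint n X)) (U : Ultrafilter (Finset (PPoint n X) → Colour n X)) : Prop :=
  (∀ B ⊆ A, B.card = n - 1 → U.map (fun K => K B) = facetColour μ B) ∧
    (A.card = n → ∀ᶠ K in (U : Filter (Finset (PPoint n X) → Colour n X)), ∃ a ∈ A, ∃ b ∈ A, colourAdj G (K (A.erase a)) (K (A.erase b)))

/-- The joint distribution of the colours of the facets contained in `A`. -/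
noncomputable def joint (A : Finset (PPoint n X)) :
    Ultrafilter (Finset (PPoint n X) → Colour n X) :=
  if h : ∃ p, IsApex A p then h.choose.2.2.map (liftCol h.choose)
  else if h : ∃ U, IsJoint μ G A U then h.choose
  else pure fun _ => c₀

theorem facetColour_of_isApex {A : Finset (PPoint n X)}
    {p : Fin n × (Fin n → PPoint n X) × Ultrafilter (Pattern n (Colour n X))} (h : IsApex A p) :
    facetColour μ A = p.2.2.map fun s => liftCol p s A := by
  have hex : ∃ p, IsApex A p := ⟨p, h⟩
  rw [facetColour, dif_pos hex, hex.choose_spec.unique h]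

theorem joint_of_isApex {A : Finset (PPoint n X)}
    {p : Fin n × (Fin n → PPoint n X) × Ultrafilter (Pattern n (Colour n X))} (h : IsApex A p) :
    joint μ G c₀ A = p.2.2.map (liftCol p) := by
  have hex : ∃ p, IsApex A p := ⟨p, h⟩
  rw [joint, dif_pos hex, hex.choose_spec.unique h]

/-- A point is coherent if the data with which it was added are compatible with the colour of the
facet opposite to it. -/
def Coherent : PPoint n X → Prop
  | .root => True
  | .ext i v F => (∀ᶠ s in (F : Filter (Pattern n (Colour n X))), s.Valid (colourAdj G) c₀ ∧ s.rel = Setoid.ker (tuple i v F)) ∧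
      ((({i}ᶜ : Finset (Fin n)).image v).card = n - 1 →
        F.map (fun s => s.col {i}ᶜ) = facetColour μ (({i}ᶜ : Finset (Fin n)).image v))

variable {μ G}

/-- The colours of two facets of a set that has no apex are joined by an edge. -/
theorem exists_adj_facetColour (hn : 3 ≤ n) (hμ : ∀ t ∈ μ, ∃ x ∈ t, ∃ y ∈ t, G x y)
    {A : Finset (PPoint n X)} (hA : A.card = n) (hp : ¬ ∃ p, IsApex A p) :
    ∃ a ∈ A, ∃ b ∈ A, a ≠ b ∧ ∀ t ∈ facetColour μ (A.erase a), ∀ t' ∈ facetColour μ (A.erase b),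
      ∃ c ∈ t, ∃ d ∈ t', colourAdj G c d := by
  obtain ⟨t, ht⟩ := exists_isTop (A := A) (Finset.card_pos.1 (by omega))
  -- As `n ≥ 3`, two points other than the top can be omitted, so both facets keep the top `t`.
  have hcard : 1 < (A.erase t).card := by
    rw [Finset.card_erase_of_mem ht.1]
    omega
  obtain ⟨a, ha, b, hb, hab⟩ := Finset.one_lt_card.1 hcard
  rw [Finset.mem_erase] at ha hb
  have htop : ∀ c, c ≠ t → IsTop (A.erase c) t := fun c hc =>
    ⟨Finset.mem_erase.2 ⟨hc.symm, ht.1⟩, fun d hd => ht.2 d (Finset.mem_of_mem_erase hd)⟩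
  -- The apex of the first facet is `t`, also the top of the second, whose generic copy therefore
  -- avoids the copies used by the ultrafilter of `t`.
  have hmixed : ∀ c d, c ≠ t → d ≠ t → (∃ p, IsApex (A.erase c) p) →
      (¬ ∃ p, IsApex (A.erase d) p) → ∀ T ∈ facetColour μ (A.erase c),
        ∀ T' ∈ facetColour μ (A.erase d), ∃ x ∈ T, ∃ y ∈ T', x.2 ≠ y.2 := by
    rintro c d hc hd ⟨p, hp⟩ hd' T hT T' hT'
    rw [facetColour_of_isApex μ hp] at hT
    rw [facetColour, dif_neg hd'] at hT'
    have e : t = ext p.1 p.2.1 p.2.2 := (htop c hc).unique hp.isTop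
    have havoid := (exists_genericCopy (A.erase d)).choose_spec p.1 p.2.1 p.2.2 (e ▸ htop d hd)
      (Finset.univ.filter fun j => tuple p.1 p.2.1 p.2.2 j ∈ A.erase c)
    obtain ⟨s, hs, hs'⟩ := (havoid.and hT).exists
    obtain ⟨x, hx⟩ := Ultrafilter.nonempty_of_mem (Ultrafilter.mem_map.1 hT')
    exact ⟨_, hs', (x, genericCopy (A.erase d)), hx, hs⟩
  refine ⟨a, ha.2, b, hb.2, hab, fun T hT T' hT' => ?_⟩
  by_cases hpa : ∃ p, IsApex (A.erase a) p
  · by_cases hpb : ∃ p, IsApex (A.erase b) p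
    · obtain ⟨p, hpa⟩ := hpa
      obtain ⟨q, hpb⟩ := hpb
      have ea := (htop a ha.1).unique hpa.isTop
      have eb := (htop b hb.1).unique hpb.isTop
      have epq : p = q := by
        have := ea.symm.trans eb
        injection this with h1 h2 h3
        exact Prod.ext h1 (Prod.ext h2 h3)
      subst epq
      -- Every point of `A` lies in one of the two facets, so their common apex is an apex of `A`.
      refine absurd ⟨p, ea ▸ ht.1, fun x hx => ?_⟩ hp
      obtain ⟨hx1, hx2⟩ := Finset.mem_erase.1 hx
      by_cases hxa : x = a
      · exact hpb.2 (Finset.mem_erase.2 ⟨hx1, Finset.mem_erase.2 ⟨hxa ▸ hab, hx2⟩⟩)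
      · exact hpa.2 (Finset.mem_erase.2 ⟨hx1, Finset.mem_erase.2 ⟨hxa, hx2⟩⟩)
    · obtain ⟨x, hx, y, hy, h⟩ := hmixed a b ha.1 hb.1 hpa hpb T hT T' hT'
      exact ⟨x, hx, y, hy, Or.inl h⟩
  · by_cases hpb : ∃ p, IsApex (A.erase b) p
    · obtain ⟨x, hx, y, hy, h⟩ := hmixed b a hb.1 ha.1 hpb hpa T' hT' T hT
      exact ⟨y, hy, x, hx, Or.inl h.symm⟩
    · rw [facetColour, dif_neg hpa] at hT
      rw [facetColour, dif_neg hpb] at hT'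
      -- Both colours are copies of `μ`; an edge inside the intersection of the two preimages serves
      -- whether or not the copies coincide.
      obtain ⟨x, hx, y, hy, hxy⟩ := hμ _ (Filter.inter_mem hT hT')
      exact ⟨_, hx.1, _, hy.2, Or.inr hxy⟩

theorem exists_isJoint (hn : 3 ≤ n) (hμ : ∀ t ∈ μ, ∃ x ∈ t, ∃ y ∈ t, G x y)
    {A : Finset (PPoint n X)} (hp : ¬ ∃ p, IsApex A p) : ∃ U, IsJoint μ G A U := by
  obtain ⟨U, hU, hR⟩ := exists_joint_ultrafilter (fun B => facetColour μ B)
    (fun K => A.card = n → ∃ a ∈ A, ∃ b ∈ A, colourAdj G (K (A.erase a)) (K (A.erase b))) (by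
      intro t ht
      choose K hK using fun B => Ultrafilter.nonempty_of_mem (ht B)
      by_cases hA : A.card = n
      · obtain ⟨a, ha, b, hb, hab, h⟩ := exists_adj_facetColour hn hμ hA hp
        obtain ⟨c, hc, d, hd, hcd⟩ := h _ (ht _) _ (ht _)
        have hne : A.erase b ≠ A.erase a := fun e => by
          have : a ∈ A.erase a := e ▸ Finset.mem_erase.2 ⟨hab, ha⟩
          exact Finset.notMem_erase a A this
        refine ⟨Function.update (Function.update K (A.erase a) c) (A.erase b) d, fun B => ?_,
          fun _ => ⟨a, ha, b, hb, ?_⟩⟩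
        · by_cases h1 : B = A.erase b
          · subst h1
            rwa [Function.update_self]
          · rw [Function.update_of_ne h1]
            by_cases h2 : B = A.erase a
            · subst h2
              rwa [Function.update_self]
            · rw [Function.update_of_ne h2]
              exact hK B
        · rwa [Function.update_self, Function.update_of_ne hne.symm, Function.update_self]
      · exact ⟨K, hK, fun h => absurd h hA⟩)
  refine ⟨U, fun B _ _ => hU B, fun hA => ?_⟩
  filter_upwards [hR] with K hK using hK hA

theorem liftCol_erase {p : Fin n × (Fin n → PPoint n X) × Ultrafilter (Pattern n (Colour n X))}
    (s : Pattern n (Colour n X)) {A : Finset (PPoint n X)} (k : Fin n)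
    (hA : Finset.univ.image (tuple p.1 p.2.1 p.2.2) = A)
    (hinj : Function.Injective (tuple p.1 p.2.1 p.2.2)) :
    liftCol p s (A.erase (tuple p.1 p.2.1 p.2.2 k)) = s.col {k}ᶜ := by
  refine congrArg s.col ?_
  ext j
  simp [← hA, hinj.eq_iff]

theorem isApex_image_tuple (i : Fin n) (v : Fin n → PPoint n X)
    (F : Ultrafilter (Pattern n (Colour n X))) :
    IsApex (Finset.univ.image (tuple i v F)) (i, v, F) := by
  refine ⟨Finset.mem_image.2 ⟨i, Finset.mem_univ i, tuple_self i v F⟩, fun x hx => ?_⟩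
  obtain ⟨h1, h2⟩ := Finset.mem_erase.1 hx
  obtain ⟨j, -, rfl⟩ := Finset.mem_image.1 h2
  have hj : j ≠ i := by
    rintro rfl
    exact h1 (tuple_self j v F)
  rw [tuple_of_ne hj]
  exact Finset.mem_image_of_mem _ (by simpa using hj)

/-- If there is an apex, facets through it read their colours off its ultrafilter by definition, and
the opposite facet agrees by coherence. Otherwise `exists_isJoint` applies. -/
theorem isJoint_joint (hn : 3 ≤ n) (hμ : ∀ t ∈ μ, ∃ x ∈ t, ∃ y ∈ t, G x y)
    {A : Finset (PPoint n X)} (hA : A.card ≤ n) (hc : ∀ a ∈ A, Coherent μ G c₀ a) :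
    IsJoint μ G A (joint μ G c₀ A) := by
  by_cases hp : ∃ p, IsApex A p
  · obtain ⟨p, hp⟩ := hp
    have hcp : Coherent μ G c₀ (ext p.1 p.2.1 p.2.2) := hc _ hp.1
    rw [joint_of_isApex μ G c₀ hp]
    refine ⟨fun B hB hBc => ?_, fun hAn => ?_⟩
    · by_cases hz : ext p.1 p.2.1 p.2.2 ∈ B
      · rw [facetColour_of_isApex μ (hp.mono hB hz)]
        rfl
      · have hAn : A.card = n := by
          have := Finset.card_lt_card (Finset.ssubset_iff_subset_ne.2
            ⟨hB, fun e => hz (e ▸ hp.1)⟩)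
          omega
        have hBe : B = A.erase (ext p.1 p.2.1 p.2.2) := by
          refine Finset.eq_of_subset_of_card_le (fun x hx => Finset.mem_erase.2
            ⟨fun e => hz (e ▸ hx), hB hx⟩) ?_
          rw [Finset.card_erase_of_mem hp.1, hAn, hBc]
        have hBi := hBe.trans (hp.eq_image hAn)
        rw [hBi, ← hcp.2 (hBi ▸ hBc)]
        refine congrArg (fun f => Ultrafilter.map f p.2.2) (funext fun s => congrArg s.col ?_)
        ext j
        by_cases hj : j = p.1
        · subst hj
          simp only [Finset.mem_filter, Finset.mem_univ, true_and, tuple_self, ← hBi, hz,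
            Finset.mem_compl, Finset.mem_singleton, not_true]
        · simp only [Finset.mem_filter, Finset.mem_univ, true_and, tuple_of_ne hj,
            Finset.mem_compl, Finset.mem_singleton, hj, not_false_eq_true, iff_true]
          exact Finset.mem_image_of_mem _ (by simpa using hj)
    · have himg : Finset.univ.image (tuple p.1 p.2.1 p.2.2) = A := by
        refine (Finset.eq_of_subset_of_card_le (fun x hx => ?_) ?_).symm
        · by_cases hx' : x = ext p.1 p.2.1 p.2.2
          · exact Finset.mem_image.2 ⟨p.1, Finset.mem_univ _, (tuple_self ..).trans hx'.symm⟩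
          · obtain ⟨j, hj, rfl⟩ := Finset.mem_image.1 (hp.2 (Finset.mem_erase.2 ⟨hx', hx⟩))
            have hj' : j ≠ p.1 := by simpa using hj
            exact Finset.mem_image.2 ⟨j, Finset.mem_univ _, tuple_of_ne hj' ..⟩
        · rw [hAn]
          exact Finset.card_image_le.trans (by simp)
      have hinj : Function.Injective (tuple p.1 p.2.1 p.2.2) := by
        rw [← Set.injOn_univ, ← Finset.coe_univ]
        exact Finset.injOn_of_card_image_eq (by rw [himg, hAn, Finset.card_univ, Fintype.card_fin])
      have h1 := hcp.1
      rw [Ultrafilter.coe_map, Filter.eventually_map]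
      filter_upwards [h1] with s ⟨hs, hsr⟩
      obtain ⟨k, l, hkl⟩ := hs.adj (hsr.trans ((Setoid.injective_iff_ker_bot _).1 hinj))
      have hmem : ∀ k, tuple p.1 p.2.1 p.2.2 k ∈ A := fun k =>
        himg ▸ Finset.mem_image_of_mem _ (Finset.mem_univ k)
      refine ⟨_, hmem k, _, hmem l, ?_⟩
      rwa [liftCol_erase s k himg hinj, liftCol_erase s l himg hinj]
  · have hU := exists_isJoint hn hμ hp
    rw [joint, dif_neg hp, dif_pos hU]
    exact hU.choose_spec

end Labels

/-! ### The ultrafilter of patterns of a tuple -/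

section Representation

open Point Pattern

variable {n : ℕ} {X : Type u} (μ : Ultrafilter X) (G : X → X → Prop) (c₀ : Colour n X)

/-- The ultrafilter of patterns realised by a tuple of points. -/
noncomputable def patternAt (v : Fin n → PPoint n X) : Ultrafilter (Pattern n (Colour n X)) :=
  (joint μ G c₀ (Finset.univ.image v)).map (ofTuple c₀ v)

variable {μ G c₀}

theorem card_image_univ_le {V : Type v} (v : Fin n → V) : (Finset.univ.image v).card ≤ n :=
  Finset.card_image_le.trans (by simp)

/-- A proper subset `A'` of `A` has fewer than `n` points, so the pattern of `v` depends on at most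
one colour, that of `A'` itself, whose distribution is prescribed. -/
theorem IsJoint.map_ofTuple {A A' : Finset (PPoint n X)} (hAA' : A' ⊆ A) (hA : A.card ≤ n)
    {U U' : Ultrafilter (Finset (PPoint n X) → Colour n X)}
    (hU : IsJoint μ G A U) (hU' : IsJoint μ G A' U') (hUU' : A = A' → U = U')
    {v : Fin n → PPoint n X} (hv : Finset.univ.image v = A') :
    U.map (ofTuple c₀ v) = U'.map (ofTuple c₀ v) := by
  by_cases hc : A = A'
  · rw [hUU' hc]
  have hlt : A'.card < n := (Finset.card_lt_card (Finset.ssubset_iff_subset_ne.2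
    ⟨hAA', Ne.symm hc⟩)).trans_le hA
  have hsub : ∀ B : Finset (Fin n), B.image v ⊆ A' := fun B =>
    hv ▸ Finset.image_subset_image (Finset.subset_univ B)
  by_cases hc' : A'.card = n - 1
  · let g : Colour n X → Pattern n (Colour n X) := fun c =>
      ⟨Setoid.ker v, fun B => if (B.image v).card = n - 1 then c else c₀⟩
    have hg : ofTuple c₀ v = g ∘ fun K : Finset (PPoint n X) → Colour n X => K A' := by
      funext K
      ext1
      · rfl
      · funext B
        by_cases hB : (B.image v).card = n - 1
        · have : B.image v = A' := Finset.eq_of_subset_of_card_le (hsub B) (by omega)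
          simp only [ofTuple, g, Function.comp, this]
        · simp only [ofTuple, g, Function.comp, if_neg hB]
    rw [hg, ← Ultrafilter.map_map, ← Ultrafilter.map_map, hU.1 A' hAA' hc',
      hU'.1 A' subset_rfl hc']
  · have hconst : ∀ K K' : Finset (PPoint n X) → Colour n X,
        ofTuple c₀ v K = ofTuple c₀ v K' := fun K K' => by
      ext1
      · rfl
      · funext B
        have hB : (B.image v).card ≠ n - 1 := by
          have := Finset.card_le_card (hsub B)
          omega
        simp only [ofTuple, if_neg hB]
    refine Ultrafilter.ext fun s => ?_
    rw [Ultrafilter.mem_map, Ultrafilter.mem_map]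
    by_cases hs : ofTuple c₀ v (fun _ => c₀) ∈ s
    · have : ofTuple c₀ v ⁻¹' s = Set.univ :=
        Set.eq_univ_of_forall fun K => by rwa [Set.mem_preimage, hconst K fun _ => c₀]
      rw [this]
      exact iff_of_true Filter.univ_mem Filter.univ_mem
    · have : ofTuple c₀ v ⁻¹' s = ∅ :=
        Set.eq_empty_of_forall_notMem fun K => by rwa [Set.mem_preimage, hconst K fun _ => c₀]
      rw [this]
      exact iff_of_false Ultrafilter.empty_notMem Ultrafilter.empty_notMem

theorem isJoint_image (hn : 3 ≤ n) (hμ : ∀ t ∈ μ, ∃ x ∈ t, ∃ y ∈ t, G x y)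
    {v : Fin n → PPoint n X} (hv : ∀ i, Coherent μ G c₀ (v i)) :
    IsJoint μ G (Finset.univ.image v) (joint μ G c₀ (Finset.univ.image v)) := by
  refine isJoint_joint c₀ hn hμ (card_image_univ_le v) fun a ha => ?_
  obtain ⟨i, -, rfl⟩ := Finset.mem_image.1 ha
  exact hv i

theorem patternAt_comp (hn : 3 ≤ n) (hμ : ∀ t ∈ μ, ∃ x ∈ t, ∃ y ∈ t, G x y)
    {v : Fin n → PPoint n X} (hv : ∀ i, Coherent μ G c₀ (v i))
    (σ : Fin n → Fin n) :
    patternAt μ G c₀ (v ∘ σ) = (patternAt μ G c₀ v).map fun s => s.subst σ := by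
  have hsub : Finset.univ.image (v ∘ σ) ⊆ Finset.univ.image v := by
    rw [← Finset.image_image]
    exact Finset.image_subset_image (Finset.subset_univ _)
  rw [patternAt, patternAt, Ultrafilter.map_map,
    ← (isJoint_image hn hμ hv).map_ofTuple hsub (card_image_univ_le v)
      (isJoint_image hn hμ (v := v ∘ σ) fun i => hv _) (fun h => by rw [h]) rfl]
  exact congrArg (fun f => Ultrafilter.map f _) (funext fun K => ofTuple_comp c₀ v K σ)

/-- The face does not see the `i`-th entry, which may be overwritten by the `j`-th; this makes the
two tuples equal. -/
theorem patternAt_face (hn : 3 ≤ n) (hμ : ∀ t ∈ μ, ∃ x ∈ t, ∃ y ∈ t, G x y)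
    {v w : Fin n → PPoint n X} (hv : ∀ i, Coherent μ G c₀ (v i))
    (hw : ∀ i, Coherent μ G c₀ (w i)) {i : Fin n} (h : ∀ j, j ≠ i → w j = v j) :
    (patternAt μ G c₀ w).map (face i) = (patternAt μ G c₀ v).map (face i) := by
  have : Nontrivial (Fin n) := Fin.nontrivial_iff_two_le.2 (by omega)
  obtain ⟨j, hj⟩ := exists_ne i
  have key : ∀ v : Fin n → PPoint n X, (∀ i, Coherent μ G c₀ (v i)) →
      (patternAt μ G c₀ v).map (face i) = (patternAt μ G c₀ (v ∘ repl i j)).map (face i) := by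
    intro v hv
    rw [patternAt_comp hn hμ hv, Ultrafilter.map_map]
    exact congrArg (fun f => Ultrafilter.map f _) (funext fun s => (face_subst_repl s i j).symm)
  rw [key v hv, key w hw]
  congr 2
  exact funext fun k => h _ (repl_ne hj k)

theorem patternAt_valid (hn : 3 ≤ n) (hμ : ∀ t ∈ μ, ∃ x ∈ t, ∃ y ∈ t, G x y)
    {v : Fin n → PPoint n X} (hv : ∀ i, Coherent μ G c₀ (v i)) :
    ∀ᶠ s in (patternAt μ G c₀ v : Filter (Pattern n (Colour n X))),
      s.Valid (colourAdj G) c₀ ∧ s.rel = Setoid.ker v := by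
  rw [patternAt, Ultrafilter.coe_map, Filter.eventually_map]
  by_cases hinj : Function.Injective v
  · have hcard : (Finset.univ.image v).card = n := by
      rw [Finset.card_image_of_injective _ hinj, Finset.card_univ, Fintype.card_fin]
    filter_upwards [(isJoint_image hn hμ hv).2 hcard] with K ⟨a, ha, b, hb, hab⟩
    obtain ⟨i, -, rfl⟩ := Finset.mem_image.1 ha
    obtain ⟨j, -, rfl⟩ := Finset.mem_image.1 hb
    refine ⟨Valid.ofTuple fun _ => ⟨i, j, ?_⟩, rfl⟩
    have himg : ∀ i, ({i}ᶜ : Finset (Fin n)).image v = (Finset.univ.image v).erase (v i) :=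
      fun i => by
        ext x
        simp only [Finset.mem_image, Finset.mem_compl, Finset.mem_singleton, Finset.mem_erase,
          Finset.mem_univ, true_and]
        constructor
        · rintro ⟨k, hk, rfl⟩
          exact ⟨fun e => hk (hinj e), k, rfl⟩
        · rintro ⟨hx, k, rfl⟩
          exact ⟨k, fun e => hx (e ▸ rfl), rfl⟩
    rwa [himg, himg]
  · exact Filter.Eventually.of_forall fun K => ⟨Valid.ofTuple fun h => absurd h hinj, rfl⟩

/-- The range of the tuple has the new point as apex, so its distribution comes from `F`; reading
the pattern back is the identity on valid patterns with the right equalities. -/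
theorem patternAt_tuple {v : Fin n → PPoint n X} {i : Fin n}
    {F : Ultrafilter (Pattern n (Colour n X))} (hF : Coherent μ G c₀ (ext i v F)) :
    patternAt μ G c₀ (tuple i v F) = F := by
  rw [patternAt, joint_of_isApex μ G c₀ (isApex_image_tuple i v F), Ultrafilter.map_map]
  refine Ultrafilter.coe_le_coe.1 fun s hs => ?_
  change _ ∈ F
  filter_upwards [hF.1, hs] with t ⟨ht, htr⟩ hts
  have : ofTuple c₀ (tuple i v F) (liftCol (i, v, F) t) = t := by
    ext1
    · exact htr.symm
    · funext B
      by_cases hB : (B.image (tuple i v F)).card = n - 1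
      · simp only [ofTuple, if_pos hB]
        refine ht.col_congr _ _ ?_
        rw [classes_eq_iff, htr]
        constructor
        · intro b hb
          obtain ⟨b', hb', e⟩ := Finset.mem_image.1 (Finset.mem_filter.1 hb).2
          exact ⟨b', hb', e.symm⟩
        · exact fun b hb => ⟨b, Finset.mem_filter.2
            ⟨Finset.mem_univ b, Finset.mem_image_of_mem _ hb⟩, rfl⟩
      · simp only [ofTuple, if_neg hB]
        refine (ht.col_of_card _ ?_).symm
        rwa [htr, card_classes_ker]
  change ofTuple c₀ (tuple i v F) (liftCol (i, v, F) t) ∈ s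
  rwa [this]

/-- Every ultrafilter of patterns that agrees with that of `v` off `i` is realised by changing the
`i`-th entry of `v`. -/
theorem exists_realisation (hn : 3 ≤ n) (hμ : ∀ t ∈ μ, ∃ x ∈ t, ∃ y ∈ t, G x y)
    {v : Fin n → PPoint n X} (hv : ∀ i, Coherent μ G c₀ (v i)) (i : Fin n)
    {Y : Set (Pattern n (Colour n X))} (hY : ∀ s ∈ Y, s.Valid (colourAdj G) c₀)
    (h : ∀ᶠ s in (patternAt μ G c₀ v : Filter (Pattern n (Colour n X))),
      ∃ y ∈ Y, face i y = face i s) :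
    ∃ z, Coherent μ G c₀ z ∧ Y ∈ patternAt μ G c₀ (Function.update v i z) := by
  -- The hypothesis makes `Y` compatible with the face of the ultrafilter of `v`, so some `F`
  -- extends both.
  have hne : (Filter.comap (face i) ((patternAt μ G c₀ v).map (face i) :
      Filter ((Fin n → Fin n → Prop) × Colour n X)) ⊓ Filter.principal Y).NeBot := by
    rw [Filter.inf_principal_neBot_iff]
    rintro s ⟨t, ht, hts⟩
    obtain ⟨p, ⟨y, hy, hyp⟩, hp⟩ := (h.and (show ∀ᶠ s in (patternAt μ G c₀ v : Filter _),
      face i s ∈ t from ht)).exists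
    exact ⟨y, hts (by rwa [Set.mem_preimage, hyp]), hy⟩
  obtain ⟨F, hF⟩ := @Ultrafilter.exists_le _ _ hne
  have hFY : Y ∈ F := hF (Filter.mem_inf_of_right (Filter.mem_principal_self Y))
  have hface : F.map (face i) = (patternAt μ G c₀ v).map (face i) := by
    refine Ultrafilter.coe_le_coe.1 ?_
    exact Filter.map_le_iff_le_comap.2 (hF.trans inf_le_left)
  have htransfer : ∀ T : Set ((Fin n → Fin n → Prop) × Colour n X),
      (face i ⁻¹' T ∈ F ↔ face i ⁻¹' T ∈ patternAt μ G c₀ v) := fun T => by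
    rw [← Ultrafilter.mem_map, hface, Ultrafilter.mem_map]
  -- Either `F` identifies the `i`-th entry with an old one, which is then reused, or the new point
  -- `ext i v F` realises `F`.
  by_cases hd : ∃ j, j ≠ i ∧ {s : Pattern n (Colour n X) | s.rel i j} ∈ F
  · obtain ⟨j, hj, hij⟩ := hd
    refine ⟨v j, hv j, ?_⟩
    have hupd : Function.update v i (v j) = v ∘ repl i j := by
      funext k
      by_cases hk : k = i
      · rw [hk, Function.update_self, Function.comp, repl_self]
      · rw [Function.update_of_ne hk, Function.comp, repl_of_ne hk]
    rw [hupd, patternAt_comp hn hμ hv, Ultrafilter.mem_map]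
    have hT := (htransfer (face i '' (Y ∩ {s | s.rel i j}))).1
      (Filter.mem_of_superset (Filter.inter_mem hFY hij) (Set.subset_preimage_image _ _))
    filter_upwards [hT, patternAt_valid hn hμ hv] with s ⟨y, ⟨hy, hyr⟩, hys⟩ hs
    have := (hY y hy).subst_repl_congr hs.1 hj hys
    rw [(hY y hy).subst_repl_of_rel hyr] at this
    rw [Set.mem_preimage, ← this]
    exact hy
  · have hFn : ∀ᶠ s in (F : Filter (Pattern n (Colour n X))), ∀ j, j ≠ i → ¬ s.rel i j := by
      rw [Filter.eventually_all]
      intro j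
      by_cases hj : j = i
      · exact Filter.Eventually.of_forall fun s h => absurd hj h
      · have : {s : Pattern n (Colour n X) | s.rel i j}ᶜ ∈ F :=
          Ultrafilter.compl_mem_iff_notMem.2 fun hm => hd ⟨j, hj, hm⟩
        filter_upwards [this] with s hs _ using hs
    have hFr : ∀ᶠ s in (F : Filter (Pattern n (Colour n X))),
        ∀ j k, j ≠ i → k ≠ i → (s.rel j k ↔ v j = v k) := by
      have := (htransfer {p | ∀ j k, j ≠ i → k ≠ i → (p.1 j k ↔ v j = v k)}).2 (by
        filter_upwards [patternAt_valid hn hμ hv] with s hs j k hj hk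
        change (j ≠ i ∧ k ≠ i ∧ s.rel j k) ↔ _
        rw [hs.2]
        simp [hj, hk, Setoid.ker_def])
      filter_upwards [this] with s hs j k hj hk
      have h2 : (j ≠ i ∧ k ≠ i ∧ s.rel j k) ↔ v j = v k := hs j k hj hk
      rw [← h2]
      exact ⟨fun h => ⟨hj, hk, h⟩, fun h => h.2.2⟩
    have hrel : ∀ᶠ s in (F : Filter (Pattern n (Colour n X))),
        s.rel = Setoid.ker (tuple i v F) := by
      filter_upwards [hFn, hFr] with s h1 h2
      ext j k
      rw [Setoid.ker_def]
      by_cases hj : j = i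
      · subst hj
        rw [tuple_self]
        by_cases hk : k = j
        · subst hk
          simp [tuple_self]
        · rw [tuple_of_ne hk]
          exact iff_of_false (h1 k hk) (ext_ne _ _ _ _)
      · by_cases hk : k = i
        · subst hk
          rw [tuple_self, tuple_of_ne hj]
          exact iff_of_false (fun h => h1 j hj (s.rel.symm h)) (ext_ne _ _ _ _).symm
        · rw [tuple_of_ne hj, tuple_of_ne hk]
          exact h2 j k hj hk
    have hcoh : Coherent μ G c₀ (ext i v F) := by
      refine ⟨?_, fun hc => ?_⟩
      · filter_upwards [hFY, hrel] with s h1 h2 using ⟨hY s h1, h2⟩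
      · have h1 : F.map (fun s => s.col {i}ᶜ) = (F.map (face i)).map Prod.snd := by
          rw [Ultrafilter.map_map]
          rfl
        rw [h1, hface, Ultrafilter.map_map, patternAt, Ultrafilter.map_map,
          ← (isJoint_image hn hμ hv).1 _ (Finset.image_subset_image (Finset.subset_univ _)) hc]
        refine congrArg (fun f => Ultrafilter.map f _) (funext fun K => ?_)
        exact if_pos hc
    refine ⟨_, hcoh, ?_⟩
    change Y ∈ patternAt μ G c₀ (tuple i v F)
    rwa [patternAt_tuple hcoh]

attribute [irreducible] patternAt

end Representation

/-! ### Strong representability from infinite chromatic number -/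

section AtomStructure

open Point Pattern

variable {n : ℕ} {X : Type u}

/-- The atoms: the valid patterns. -/
abbrev PatternAtom (G : X → X → Prop) (c₀ : Colour n X) : Type u :=
  {s : Pattern n (Colour n X) // s.Valid (colourAdj G) c₀}

/-- The relations on the atoms, by function symbols. -/
def patternRel {G : X → X → Prop} {c₀ : Colour n X} :
    {k : ℕ} → PEAFunc n k → (Fin (k + 1) → PatternAtom G c₀) → Prop
  | _, .cyl i, x => face i (x 0).1 = face i (x 1).1
  | _, .diag i j, x => (x 0).1.rel i j
  | _, .subst σ, x => (x 0).1 = (x 1).1.subst σ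
  | _, .zero, _ => False
  | _, .one, _ => False
  | _, .neg, _ => False
  | _, .add, _ => False

/-- The atom structure of the patterns. -/
instance patternAtomStructure (L : Signature n) (G : X → X → Prop) (c₀ : Colour n X) :
    L.atomLang.Structure (PatternAtom G c₀) where
  funMap f := nomatch f
  RelMap {k} := match k with
    | 0 => fun r => nomatch r
    | _ + 1 => fun r x => patternRel r.1 x

variable {G : X → X → Prop} {c₀ : Colour n X}

theorem complexOp_cyl {L : Signature n} {i : Fin n} (h : PEAFunc.cyl i ∈ L 1)
    (x : Fin 1 → Set (PatternAtom G c₀)) :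
    complexOp (Signature.R (L := L) (.cyl i) h id) x = {s | ∃ y ∈ x 0, face i y.1 = face i s.1} := by
  ext s
  constructor
  · rintro ⟨y, hy, hr⟩
    exact ⟨y 0, hy 0, hr⟩
  · rintro ⟨y, hy, hr⟩
    exact ⟨fun _ => y, fun i => by rwa [Subsingleton.elim i 0], hr⟩

theorem complexOp_diag {L : Signature n} {i j : Fin n} (h : PEAFunc.diag i j ∈ L 0)
    (x : Fin 0 → Set (PatternAtom G c₀)) :
    complexOp (Signature.R (L := L) (.diag i j) h id) x = {s | s.1.rel i j} := by
  ext s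
  constructor
  · rintro ⟨y, hy, hr⟩
    exact hr
  · intro hr
    exact ⟨Fin.elim0, fun i => i.elim0, hr⟩

theorem complexOp_subst {L : Signature n} {σ : Fin n → Fin n} (h : PEAFunc.subst σ ∈ L 1)
    (x : Fin 1 → Set (PatternAtom G c₀)) :
    complexOp (Signature.R (L := L) (.subst σ) h id) x =
      {s | (⟨s.1.subst σ, s.2.subst σ⟩ : PatternAtom G c₀) ∈ x 0} := by
  ext s
  constructor
  · rintro ⟨y, hy, hr⟩
    have : y 0 = ⟨s.1.subst σ, s.2.subst σ⟩ := Subtype.ext hr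
    change (⟨s.1.subst σ, s.2.subst σ⟩ : PatternAtom G c₀) ∈ x 0
    rw [← this]
    exact hy 0
  · intro hr
    refine ⟨fun _ => ⟨s.1.subst σ, s.2.subst σ⟩, fun i => ?_, rfl⟩
    rw [Subsingleton.elim i 0]
    exact hr

/-- The base of the representation. -/
abbrev Base (μ : Ultrafilter X) (G : X → X → Prop) (c₀ : Colour n X) : Type u :=
  {z : PPoint n X // Coherent μ G c₀ z}

variable {μ : Ultrafilter X}

/-- The representation of sets of atoms as sets of tuples of points. -/
def represent (μ : Ultrafilter X) (Y : Set (PatternAtom G c₀)) : Set (Fin n → Base μ G c₀) :=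
  {v | Subtype.val '' Y ∈ patternAt μ G c₀ fun i => (v i).1}

theorem mem_represent {Y : Set (PatternAtom G c₀)} {v : Fin n → Base μ G c₀} :
    v ∈ represent μ Y ↔ Subtype.val '' Y ∈ patternAt μ G c₀ fun i => (v i).1 := Iff.rfl

theorem represent_mono {Y Z : Set (PatternAtom G c₀)} (h : Y ⊆ Z) :
    represent μ Y ⊆ represent μ Z := fun _ hv =>
  Filter.mem_of_superset hv (Set.image_mono h)

theorem represent_empty : represent μ (∅ : Set (PatternAtom G c₀)) = ∅ := by
  refine Set.eq_empty_of_forall_notMem fun v hv => ?_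
  rw [mem_represent, Set.image_empty] at hv
  exact Ultrafilter.empty_notMem hv

theorem represent_union (Y Z : Set (PatternAtom G c₀)) :
    represent μ (Y ∪ Z) = represent μ Y ∪ represent μ Z := by
  ext v
  rw [mem_represent, Set.image_union, Ultrafilter.union_mem_iff]
  rfl

theorem represent_univ (hn : 3 ≤ n) (hμ : ∀ t ∈ μ, ∃ x ∈ t, ∃ y ∈ t, G x y) :
    represent μ (Set.univ : Set (PatternAtom G c₀)) = Set.univ := by
  refine Set.eq_univ_of_forall fun v => ?_
  filter_upwards [patternAt_valid hn hμ fun i => (v i).2] with s hs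
  exact ⟨⟨s, hs.1⟩, Set.mem_univ _, rfl⟩

theorem represent_compl (hn : 3 ≤ n) (hμ : ∀ t ∈ μ, ∃ x ∈ t, ∃ y ∈ t, G x y)
    (Y : Set (PatternAtom G c₀)) : represent μ Yᶜ = (represent μ Y)ᶜ := by
  ext v
  constructor
  · intro h1 h2
    obtain ⟨_, ⟨⟨s, hs, rfl⟩, ⟨t, ht, hst⟩⟩⟩ :=
      Ultrafilter.nonempty_of_mem (Filter.inter_mem h1 h2)
    exact hs (Subtype.ext hst ▸ ht)
  · intro h
    have h1 : v ∈ represent μ (Y ∪ Yᶜ) := by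
      rw [Set.union_compl_self, represent_univ hn hμ]
      exact Set.mem_univ v
    rw [represent_union] at h1
    exact h1.resolve_left h

theorem represent_cyl (hn : 3 ≤ n) (hμ : ∀ t ∈ μ, ∃ x ∈ t, ∃ y ∈ t, G x y)
    (i : Fin n) (Y : Set (PatternAtom G c₀)) :
    represent μ {s : PatternAtom G c₀ | ∃ y ∈ Y, face i y.1 = face i s.1} =
      {v | ∃ w ∈ represent μ Y, ∀ j, j ≠ i → w j = v j} := by
  ext v
  constructor
  · intro hv
    obtain ⟨z, hz, hY⟩ := exists_realisation hn hμ (fun j => (v j).2) i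
      (Y := Subtype.val '' Y) (by rintro _ ⟨y, -, rfl⟩; exact y.2) (by
        filter_upwards [hv] with s hs
        obtain ⟨s, ⟨y, hy, hys⟩, rfl⟩ := hs
        exact ⟨y.1, ⟨y, hy, rfl⟩, hys⟩)
    refine ⟨Function.update v i ⟨z, hz⟩, ?_, fun j hj => Function.update_of_ne hj ..⟩
    have : (fun j => (Function.update v i ⟨z, hz⟩ j).1) =
        Function.update (fun j => (v j).1) i z := by
      funext j
      by_cases hj : j = i
      · subst hj
        rw [Function.update_self, Function.update_self]
      · rw [Function.update_of_ne hj, Function.update_of_ne hj]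
    rw [mem_represent, this]
    exact hY
  · rintro ⟨w, hw, hwv⟩
    have h1 : face i '' (Subtype.val '' Y) ∈ (patternAt μ G c₀ fun j => (w j).1).map (face i) :=
      Ultrafilter.mem_map.2 (Filter.mem_of_superset hw (Set.subset_preimage_image _ _))
    rw [patternAt_face hn hμ (fun j => (v j).2) (fun j => (w j).2)
      (fun j hj => congrArg Subtype.val (hwv j hj)), Ultrafilter.mem_map] at h1
    filter_upwards [h1, patternAt_valid hn hμ fun i => (v i).2] with s h2 h3
    obtain ⟨_, ⟨y, hy, rfl⟩, hys⟩ := h2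
    exact ⟨⟨s, h3.1⟩, ⟨y, hy, hys⟩, rfl⟩

theorem represent_diag (hn : 3 ≤ n) (hμ : ∀ t ∈ μ, ∃ x ∈ t, ∃ y ∈ t, G x y) (i j : Fin n) :
    represent μ {s : PatternAtom G c₀ | s.1.rel i j} = {v | v i = v j} := by
  ext v
  have hval := patternAt_valid hn hμ fun i => (v i).2
  constructor
  · intro hv
    obtain ⟨s, ⟨s, hs, rfl⟩, h⟩ := Ultrafilter.nonempty_of_mem (Filter.inter_mem hv hval)
    have hs' : s.1.rel i j := hs
    rw [h.2] at hs'
    exact Subtype.ext hs'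
  · intro hv
    filter_upwards [hval] with s hs
    refine ⟨⟨s, hs.1⟩, ?_, rfl⟩
    change s.rel i j
    rw [hs.2]
    exact congrArg Subtype.val hv

theorem represent_subst (hn : 3 ≤ n) (hμ : ∀ t ∈ μ, ∃ x ∈ t, ∃ y ∈ t, G x y)
    (σ : Fin n → Fin n) (Y : Set (PatternAtom G c₀)) :
    represent μ {s : PatternAtom G c₀ | (⟨s.1.subst σ, s.2.subst σ⟩ : PatternAtom G c₀) ∈ Y} =
      {v | v ∘ σ ∈ represent μ Y} := by
  ext v
  have hcomp : (patternAt μ G c₀ fun i => ((v ∘ σ) i).1) = _ :=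
    patternAt_comp hn hμ (fun i => (v i).2) σ
  have hval := patternAt_valid hn hμ fun i => (v i).2
  change _ ↔ v ∘ σ ∈ represent μ Y
  rw [mem_represent, mem_represent, hcomp, Ultrafilter.mem_map]
  constructor
  · intro hv
    filter_upwards [hv] with s hs
    obtain ⟨s, hs, rfl⟩ := hs
    exact ⟨_, hs, rfl⟩
  · intro hv
    filter_upwards [hv, hval] with s hs hs'
    obtain ⟨y, hy, hys⟩ := hs
    refine ⟨⟨s, hs'.1⟩, ?_, rfl⟩
    have : y = ⟨s.subst σ, hs'.1.subst σ⟩ := Subtype.ext hys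
    change (⟨s.subst σ, hs'.1.subst σ⟩ : PatternAtom G c₀) ∈ Y
    rwa [← this]

/-- Start from a constant tuple and correct one entry at a time by `represent_cyl`. This gives the
injectivity of `represent`. -/
theorem exists_mem_represent (hn : 3 ≤ n) (hμ : ∀ t ∈ μ, ∃ x ∈ t, ∃ y ∈ t, G x y)
    (s : PatternAtom G c₀) : ∃ v, v ∈ represent μ {s} := by
  let o : Fin n := ⟨0, by omega⟩
  -- `σ k` keeps the first `k` indices and collapses the others to `0`; `σ k` and `σ (k + 1)` differ
  -- at most at index `k`.
  let σ : ℕ → Fin n → Fin n := fun k j => if j.val < k then j else o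
  have key : ∀ k ≤ n, ∃ v, v ∈ represent μ {(⟨s.1.subst (σ k), s.2.subst (σ k)⟩ :
      PatternAtom G c₀)} := by
    intro k
    induction k with
    | zero =>
      intro _
      refine ⟨fun _ => ⟨.root, trivial⟩, ?_⟩
      filter_upwards [patternAt_valid (c₀ := c₀) hn hμ (v := fun _ : Fin n => Point.root)
        fun _ => trivial] with t ht
      refine ⟨_, rfl, ?_⟩
      have hσ : ∀ j, σ 0 j = o := fun j => if_neg (Nat.not_lt_zero _)
      have hrel : (s.1.subst (σ 0)).rel = t.rel := by
        rw [ht.2]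
        ext a b
        change s.1.rel (σ 0 a) (σ 0 b) ↔ _
        rw [hσ, hσ]
        exact iff_of_true (s.1.rel.refl _) rfl
      -- A constant tuple has one class and `n - 1 ≥ 2`, so every colour is the default `c₀`.
      have hcard : ∀ B, (classes t.rel B).card ≠ n - 1 := fun B => by
        rw [ht.2, card_classes_ker]
        have : (B.image fun _ : Fin n => (Point.root : PPoint n X)).card ≤ 1 :=
          (Finset.card_le_card (Finset.image_subset_iff.2 fun _ _ =>
            Finset.mem_singleton_self _)).trans (Finset.card_singleton _).le
        omega
      refine Pattern.ext hrel (funext fun B => ?_)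
      rw [ht.1.col_of_card B (hcard B)]
      refine (s.2.subst (σ 0)).col_of_card B ?_
      rw [hrel]
      exact hcard B
    | succ k ih =>
      intro hk
      obtain ⟨v, hv⟩ := ih (by omega)
      have hsub := represent_mono (μ := μ) (Z := {t : PatternAtom G c₀ |
        ∃ y ∈ ({(⟨s.1.subst (σ (k + 1)), s.2.subst (σ (k + 1))⟩ : PatternAtom G c₀)} : Set _),
          face ⟨k, hk⟩ y.1 = face ⟨k, hk⟩ t.1}) (Set.singleton_subset_iff.2 ⟨_, rfl, by
            refine face_subst_congr fun j hj => ?_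
            have hj' : j.val ≠ k := fun e => hj (Fin.ext e)
            by_cases h : j.val < k
            · simp only [σ, if_pos h, if_pos (Nat.lt_succ_of_lt h)]
            · simp only [σ, if_neg h, if_neg (show ¬ j.val < k + 1 by omega)]⟩) hv
      rw [represent_cyl hn hμ] at hsub
      obtain ⟨w, hw, -⟩ := hsub
      exact ⟨w, hw⟩
  have hid : (⟨s.1.subst (σ n), s.2.subst (σ n)⟩ : PatternAtom G c₀) = s := by
    refine Subtype.ext ?_
    have : σ n = id := funext fun j => if_pos j.2
    change s.1.subst (σ n) = s.1
    rw [this, subst_id]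
  have := key n le_rfl
  rwa [hid] at this

theorem represent_injective (hn : 3 ≤ n) (hμ : ∀ t ∈ μ, ∃ x ∈ t, ∃ y ∈ t, G x y) :
    Function.Injective (represent μ : Set (PatternAtom G c₀) → _) := by
  have key : ∀ Y Z : Set (PatternAtom G c₀), represent μ Y = represent μ Z → Y ⊆ Z := by
    intro Y Z h s hs
    obtain ⟨v, hv⟩ := exists_mem_represent hn hμ s
    have hZ : v ∈ represent μ Z := h ▸ represent_mono (Set.singleton_subset_iff.2 hs) hv
    obtain ⟨_, ⟨_, rfl, rfl⟩, ⟨t, ht, hts⟩⟩ :=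
      Ultrafilter.nonempty_of_mem (Filter.inter_mem hv hZ)
    exact Subtype.ext hts ▸ ht
  exact fun Y Z h => (key Y Z h).antisymm (key Z Y h.symm)

/-- If the chromatic number of the graph is infinite then the atom structure of the patterns is
strongly representable. -/
theorem isStronglyRepresentable_patternAtom (hn : 3 ≤ n) (L : Signature n)
    (hG : InfiniteChromatic G) (c₀ : Colour n X) :
    IsStronglyRepresentable L (PatternAtom G c₀) := by
  obtain ⟨μ, hμ⟩ := hG.exists_ultrafilter
  have hne : Nonempty (Base μ G c₀) := ⟨⟨.root, trivial⟩⟩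
  by_cases hL : L ≤ LDf n
  · refine Or.inl ⟨hL, PUnit, fun _ _ => Base μ G c₀, fun _ _ => hne, ⟨⟨⟨fun Y _ => represent μ Y,
      fun Y Z h => represent_injective hn hμ (congrFun h PUnit.unit)⟩, ?_, ?_⟩⟩⟩
    · rintro k ⟨f, hf⟩ x
      funext _
      have hf' := hL _ hf
      cases f with
      | zero => exact represent_empty
      | one => exact represent_univ hn hμ
      | neg => exact represent_compl hn hμ _
      | add => exact represent_union _ _
      | cyl i => exact (congrArg (represent μ) (complexOp_cyl hf x)).trans (represent_cyl hn hμ i _)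
      | diag i j => exact hf'.elim
      | subst σ => exact hf'.elim
    · intro k r
      exact nomatch r
  · refine Or.inr ⟨hL, PUnit, fun _ => Base μ G c₀, fun _ => hne, ⟨⟨⟨fun Y _ => represent μ Y,
      fun Y Z h => represent_injective hn hμ (congrFun h PUnit.unit)⟩, ?_, ?_⟩⟩⟩
    · rintro k ⟨f, hf⟩ x
      funext _
      cases f with
      | zero => exact represent_empty
      | one => exact represent_univ hn hμ
      | neg => exact represent_compl hn hμ _
      | add => exact represent_union _ _
      | cyl i => exact (congrArg (represent μ) (complexOp_cyl hf x)).trans (represent_cyl hn hμ i _)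
      | diag i j => exact (congrArg (represent μ) (complexOp_diag hf x)).trans
                        (represent_diag hn hμ i j)
      | subst σ => exact (congrArg (represent μ) (complexOp_subst hf x)).trans
                        (represent_subst hn hμ σ _)
    · intro k r
      exact nomatch r

end AtomStructure

/-! ### Iterated ultrafilters -/

/-- The iterated product of an ultrafilter with itself. -/
noncomputable def iterUltrafilter {J : Type v} (D : Ultrafilter J) :
    (k : ℕ) → Ultrafilter (Fin k → J)
  | 0 => pure Fin.elim0
  | k + 1 => D.bind fun c => (iterUltrafilter D k).map (Fin.cons c)

section Iter

variable {J : Type v} {D : Ultrafilter J}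

theorem eventually_iter_succ {k : ℕ} {P : (Fin (k + 1) → J) → Prop} :
    (∀ᶠ κ in (iterUltrafilter D (k + 1) : Filter (Fin (k + 1) → J)), P κ) ↔
      ∀ᶠ c in (D : Filter J), ∀ᶠ t in (iterUltrafilter D k : Filter (Fin k → J)),
        P (Fin.cons c t) := Iff.rfl

/-- The first variable is the outermost limit: deleting it leaves the iterated product of one
dimension less, and deleting a later one is the inductive case. -/
theorem eventually_iter_comp_succAbove {k : ℕ} (i : Fin (k + 1)) {P : (Fin k → J) → Prop}
    (h : ∀ᶠ t in (iterUltrafilter D k : Filter (Fin k → J)), P t) :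
    ∀ᶠ κ in (iterUltrafilter D (k + 1) : Filter (Fin (k + 1) → J)), P (κ ∘ i.succAbove) := by
  induction k with
  | zero =>
    refine eventually_iter_succ.2 (Filter.Eventually.of_forall fun c => ?_)
    filter_upwards [h] with t ht
    rwa [Subsingleton.elim (_ ∘ _) t]
  | succ k ih =>
    refine eventually_iter_succ.2 ?_
    refine Fin.cases ?_ (fun i => ?_) i
    · refine Filter.Eventually.of_forall fun c => ?_
      filter_upwards [h] with t ht
      exact ht
    · filter_upwards [eventually_iter_succ.1 h] with c hc
      filter_upwards [ih i hc] with t ht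
      convert ht using 1
      funext j
      refine Fin.cases ?_ (fun j => ?_) j
      · simp
      · simp

theorem eventually_iter_ne (hD : ∀ c, ∀ᶠ c' in (D : Filter J), c' ≠ c) (k : ℕ) (c : J) :
    ∀ᶠ t in (iterUltrafilter D k : Filter (Fin k → J)), ∀ j, t j ≠ c := by
  induction k with
  | zero => exact Filter.Eventually.of_forall fun t j => j.elim0
  | succ k ih =>
    refine eventually_iter_succ.2 ?_
    filter_upwards [hD c] with c' hc'
    filter_upwards [ih] with t ht j
    exact Fin.cases hc' ht j

theorem eventually_iter_injective (hD : ∀ c, ∀ᶠ c' in (D : Filter J), c' ≠ c) (k : ℕ) :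
    ∀ᶠ t in (iterUltrafilter D k : Filter (Fin k → J)), Function.Injective t := by
  induction k with
  | zero => exact Filter.Eventually.of_forall fun t j => j.elim0
  | succ k ih =>
    refine eventually_iter_succ.2 (Filter.Eventually.of_forall fun c => ?_)
    filter_upwards [ih, eventually_iter_ne hD k c] with t h1 h2
    rw [Fin.cons_injective_iff]
    exact ⟨fun ⟨j, hj⟩ => h2 j hj, h1⟩

end Iter

/-! ### The obstruction to representability -/

/-- Diagonals, and colours of the facets, on a set with relations `E i`. -/
structure FacetColouring {n : ℕ} {M : Type u} (E : Fin n → M → M → Prop) (C : Type v) where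
  diag : Fin n → Fin n → Set M
  col : Fin n → M → C
  diag_symm : ∀ {i j s}, s ∈ diag i j → s ∈ diag j i
  diag_trans : ∀ {i j k s}, s ∈ diag i j → s ∈ diag j k → s ∈ diag i k
  diag_iff : ∀ {i j k x s}, k ≠ i → k ≠ j → E k x s → (x ∈ diag i j ↔ s ∈ diag i j)
  exists_diag : ∀ {i j}, i ≠ j → ∀ s, ∃ x ∈ diag i j, E i x s
  exists_fresh : ∀ i s, ∃ x, (∀ j, j ≠ i → x ∉ diag i j) ∧ E i x s
  col_eq : ∀ {i x s}, E i x s → col i x = col i s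
  col_diag : ∀ {i j s}, i ≠ j → s ∈ diag i j → col i s = col j s

namespace FacetColouring

variable {n : ℕ} {M : Type u} {E : Fin n → M → M → Prop} {C : Type v} (F : FacetColouring E C)
  {U : Fin n → Type w} {T : (∀ i, U i) → Ultrafilter M}

/-- The ultrafilters `T p` of elements realised at the points `p` form a representation of the
cylindrifications. -/
def IsRealisation (E : Fin n → M → M → Prop) (T : (∀ i, U i) → Ultrafilter M) : Prop :=
  ∀ i (Y : Set M) p, {s | ∃ y ∈ Y, E i y s} ∈ T p ↔ ∃ q, Y ∈ T q ∧ ∀ j, j ≠ i → q j = p j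

theorem mem_of_closed (hT : IsRealisation E T) {i : Fin n} {Y : Set M}
    (hY : ∀ x s, E i x s → x ∈ Y → s ∈ Y) {p q : ∀ i, U i} (hp : Y ∈ T p)
    (h : ∀ j, j ≠ i → p j = q j) : Y ∈ T q := by
  refine Filter.mem_of_superset ((hT i Y q).2 ⟨p, hp, h⟩) ?_
  rintro s ⟨y, hy, hys⟩
  exact hY y s hys hy

theorem exists_of_forall (hT : IsRealisation E T) {i : Fin n} {Y Z : Set M} {p : ∀ i, U i}
    (hZ : Z ∈ T p) (h : ∀ s ∈ Z, ∃ y ∈ Y, E i y s) :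
    ∃ q, Y ∈ T q ∧ ∀ j, j ≠ i → q j = p j :=
  (hT i Y p).1 (Filter.mem_of_superset hZ h)

theorem map_col_eq (hT : IsRealisation E T) {i : Fin n} {p q : ∀ i, U i}
    (h : ∀ j, j ≠ i → p j = q j) : (T p).map (F.col i) = (T q).map (F.col i) := by
  refine (Ultrafilter.coe_le_coe.1 fun Z hZ => ?_)
  exact mem_of_closed hT (Y := F.col i ⁻¹' Z) (fun x s hxs hx => by
    rw [Set.mem_preimage, ← F.col_eq hxs]
    exact hx) hZ fun j hj => (h j hj).symm

/-- The other coordinates are changed one at a time, since `diag i j` is closed under each `E k`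
with `k` different from `i` and `j`. -/
theorem diag_mem (hT : IsRealisation E T) {i j : Fin n} {p q : ∀ i, U i}
    (hp : F.diag i j ∈ T p) (hi : p i = q i) (hj : p j = q j) : F.diag i j ∈ T q := by
  have key : ∀ B : Finset (Fin n), i ∉ B → j ∉ B → F.diag i j ∈ T (B.piecewise q p) := by
    intro B
    induction B using Finset.induction_on with
    | empty =>
      intro _ _
      rwa [Finset.piecewise_empty]
    | insert k B hk ih =>
      intro h1 h2
      rw [Finset.mem_insert, not_or] at h1 h2
      refine mem_of_closed hT (i := k) (fun x s hxs hx =>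
        (F.diag_iff (Ne.symm h1.1) (Ne.symm h2.1) hxs).1 hx) (ih h1.2 h2.2) fun l hl => ?_
      rw [Finset.piecewise_insert, Function.update_of_ne hl]
  have := key ({i, j}ᶜ) (by simp) (by simp)
  convert this using 2
  funext k
  by_cases hk : k = i
  · subst hk
    simp [Finset.piecewise, hi]
  · by_cases hk' : k = j
    · subst hk'
      simp [Finset.piecewise, hj]
    · simp [Finset.piecewise, hk, hk']

theorem exists_injective (hT : IsRealisation E T) [∀ i, Nonempty (U i)] :
    ∃ p : ∀ i, U i, ∀ᶠ s in (T p : Filter M), ∀ i j, i ≠ j → s ∉ F.diag i j := by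
  have key : ∀ B : Finset (Fin n), ∃ p : ∀ i, U i, ∀ i ∈ B, ∀ j, i ≠ j →
      ∀ᶠ s in (T p : Filter M), s ∉ F.diag i j := by
    intro B
    induction B using Finset.induction_on with
    | empty => exact ⟨fun i => Classical.arbitrary _, by simp⟩
    | insert k B hk ih =>
      obtain ⟨p, hp⟩ := ih
      obtain ⟨q, hq, hqp⟩ := exists_of_forall hT (i := k) (Z := Set.univ) (p := p) Filter.univ_mem
        fun s _ => F.exists_fresh k s
      have hk' : ∀ j, j ≠ k → ∀ᶠ s in (T q : Filter M), s ∉ F.diag k j := fun j hj => by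
        filter_upwards [hq] with s hs using hs j hj
      refine ⟨q, fun i hi j hij => ?_⟩
      by_cases hik : i = k
      · subst hik
        exact hk' j hij.symm
      · by_cases hjk : j = k
        · subst hjk
          filter_upwards [hk' i hij] with s hs h using hs (F.diag_symm h)
        · exact mem_of_closed hT (i := k) (Y := (F.diag i j)ᶜ) (fun x s hxs hx h =>
            hx ((F.diag_iff (Ne.symm hik) (Ne.symm hjk) hxs).2 h))
            (hp i (Finset.mem_of_mem_insert_of_ne hi hik) j hij) fun l hl => (hqp l hl).symm
  obtain ⟨p, hp⟩ := key Finset.univ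
  refine ⟨p, ?_⟩
  simp only [Filter.eventually_all]
  exact fun i j hij => hp i (Finset.mem_univ i) j hij

/-- A point all of whose coordinates are identified by the diagonals. -/
def IsConstant (T : (∀ i, U i) → Ultrafilter M) (x : ∀ i, U i) : Prop :=
  ∀ i j, i ≠ j → F.diag i j ∈ T x

/-- The sets `U i` are unrelated. A constant point supplies one coordinate in each `U i`, and these
play the part of a single element of a common base. -/
theorem exists_isConstant (hT : IsRealisation E T) (p : ∀ i, U i) (l : Fin n) :
    ∃ x, F.IsConstant T x ∧ x l = p l := by
  have key : ∀ B : Finset (Fin n), ∃ q : ∀ i, U i, q l = p l ∧ ∀ j ∈ B, j ≠ l →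
      F.diag j l ∈ T q := by
    intro B
    induction B using Finset.induction_on with
    | empty => exact ⟨p, rfl, by simp⟩
    | insert k B hk ih =>
      obtain ⟨p, hpl, hp⟩ := ih
      by_cases hkl : k = l
      · refine ⟨p, hpl, fun j hj hjl => hp j (Finset.mem_of_mem_insert_of_ne hj ?_) hjl⟩
        exact hkl ▸ hjl
      · obtain ⟨q, hq, hqp⟩ := exists_of_forall hT (i := k) (Z := Set.univ) (p := p)
          Filter.univ_mem fun s _ => F.exists_diag hkl s
        refine ⟨q, (hqp l (Ne.symm hkl)).trans hpl, fun j hj hjl => ?_⟩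
        by_cases hjk : j = k
        · rwa [hjk]
        · exact F.diag_mem hT (hp j (Finset.mem_of_mem_insert_of_ne hj hjk) hjl)
            (hqp j hjk).symm (hqp l (Ne.symm hkl)).symm
  obtain ⟨q, hql, hq⟩ := key Finset.univ
  refine ⟨q, fun i j hij => ?_, hql⟩
  by_cases hi : i = l
  · subst hi
    filter_upwards [hq j (Finset.mem_univ j) hij.symm] with s hs using F.diag_symm hs
  · by_cases hj : j = l
    · subst hj
      exact hq i (Finset.mem_univ i) hij
    · filter_upwards [hq i (Finset.mem_univ i) hi, hq j (Finset.mem_univ j) hj] with s h1 h2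
      exact F.diag_trans h1 (F.diag_symm h2)

/-- The constant points `x` and `y` are identified by the diagonal `i j`. -/
def Identified (T : (∀ i, U i) → Ultrafilter M) (x y : ∀ i, U i) (i j : Fin n) : Prop :=
  ∃ z : ∀ i, U i, z i = x i ∧ z j = y j ∧ F.diag i j ∈ T z

variable {F}

theorem Identified.right (hT : IsRealisation E T) {x y : ∀ i, U i} (hy : F.IsConstant T y)
    {i j k : Fin n} (h : F.Identified T x y i j) (hki : k ≠ i) (hkj : k ≠ j) :
    F.Identified T x y i k := by
  obtain ⟨z, hi, hj, hz⟩ := h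
  refine ⟨Function.update z k (y k), by rw [Function.update_of_ne hki.symm, hi],
    Function.update_self .., ?_⟩
  have h1 := F.diag_mem hT hz (q := Function.update z k (y k))
    (by rw [Function.update_of_ne hki.symm]) (by rw [Function.update_of_ne hkj.symm])
  have h2 := F.diag_mem hT (hy j k hkj.symm) (q := Function.update z k (y k))
    (by rw [Function.update_of_ne hkj.symm, hj]) (by rw [Function.update_self])
  filter_upwards [h1, h2] with s h1 h2 using F.diag_trans h1 h2

theorem Identified.left (hT : IsRealisation E T) {x y : ∀ i, U i} (hx : F.IsConstant T x)
    {i j k : Fin n} (h : F.Identified T x y i j) (hki : k ≠ i) (hkj : k ≠ j) :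
    F.Identified T x y k j := by
  obtain ⟨z, hi, hj, hz⟩ := h
  refine ⟨Function.update z k (x k), Function.update_self ..,
    by rw [Function.update_of_ne hkj.symm, hj], ?_⟩
  have h1 := F.diag_mem hT hz (q := Function.update z k (x k))
    (by rw [Function.update_of_ne hki.symm]) (by rw [Function.update_of_ne hkj.symm])
  have h2 := F.diag_mem hT (hx k i hki) (q := Function.update z k (x k))
    (by rw [Function.update_self]) (by rw [Function.update_of_ne hki.symm, hi])
  filter_upwards [h1, h2] with s h1 h2 using F.diag_trans h2 h1

/-- One index is changed at a time, by transitivity through the diagonals of `x` and `y`. If `a =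
j`, a third index is needed as an intermediate stop. -/
theorem Identified.move (hn : 3 ≤ n) (hT : IsRealisation E T) {x y : ∀ i, U i}
    (hx : F.IsConstant T x) (hy : F.IsConstant T y) {i j a b : Fin n} (hij : i ≠ j) (hab : a ≠ b)
    (h : F.Identified T x y i j) : F.Identified T x y a b := by
  have h1 : ∀ j, a ≠ j → F.Identified T x y a j → F.Identified T x y a b := fun j hj h => by
    by_cases hbj : b = j
    · rwa [hbj]
    · exact h.right hT hy hab.symm hbj
  by_cases hia : a = i
  · subst hia
    exact h1 j hij h
  · by_cases hja : a = j
    · subst hja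
      obtain ⟨k, hk⟩ : ∃ k : Fin n, k ∉ ({i, a} : Finset (Fin n)) := by
        by_contra hcon
        push Not at hcon
        have := Finset.card_le_card (Finset.subset_iff.2 fun k (_ : k ∈ Finset.univ) => hcon k)
        rw [Finset.card_univ, Fintype.card_fin] at this
        have := Finset.card_le_two (a := i) (b := a)
        omega
      rw [Finset.mem_insert, Finset.mem_singleton, not_or] at hk
      have h2 := h.right hT hy hk.1 hk.2
      exact h1 k (Ne.symm hk.2) (h2.left hT hx hia (Ne.symm hk.2))
    · exact h1 j hja (h.left hT hx hia hja)

/-- Changing the `b`-th entry of an injective tuple `p` gives the facet opposite `a` any colour `e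
c`; the constant `x c` is made from the new entry. If `x c` and `x d` were identified, both would
equal the same `a`-th entry, and through the shared facet opposite `b` the colours `e c` and `e d`
would agree. -/
theorem exists_constant_family (F : FacetColouring E C) (hn : 3 ≤ n) (hT : IsRealisation E T)
    [∀ i, Nonempty (U i)] {J : Type v} {e : J → C} (he : Function.Injective e)
    (hJ : ∀ s, (∀ i j, i ≠ j → s ∉ F.diag i j) → ∀ i j, i ≠ j → ∀ c,
      ∃ y, F.col i y = e c ∧ E j y s) :
    ∃ x : J → ∀ i, U i, (∀ c, F.IsConstant T (x c)) ∧
      ∀ c d, c ≠ d → ∀ i j, i ≠ j → ¬ F.Identified T (x c) (x d) i j := by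
  obtain ⟨p, hp⟩ := F.exists_injective hT
  let a : Fin n := ⟨0, by omega⟩
  let b : Fin n := ⟨1, by omega⟩
  have hab : a ≠ b := by simp [a, b]
  have hq : ∀ c, ∃ q : ∀ i, U i, {s | F.col a s = e c} ∈ T q ∧ ∀ j, j ≠ b → q j = p j :=
    fun c => exists_of_forall hT hp fun s hs => hJ s hs a b hab c
  choose q hqc hqp using hq
  choose x hx hxq using fun c => F.exists_isConstant hT (q c) b
  refine ⟨x, hx, fun c d hcd i j hij hid => ?_⟩
  obtain ⟨z, hza, hzb, hz⟩ := hid.move hn hT (hx c) (hx d) hij hab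
  -- `y c` and `y d` differ only at `b`, so share the facet opposite `b`; both satisfy `diag a b`,
  -- which equates its colour with that of the facet opposite `a`.
  let y : J → ∀ i, U i := fun d => Function.update (Function.update p a (x c a)) b (x d b)
  have hya : ∀ d, y d a = x c a := fun d => by
    simp only [y]
    rw [Function.update_of_ne hab, Function.update_self]
  have hyb : ∀ d, y d b = x d b := fun d => Function.update_self ..
  have hyp : ∀ d k, k ≠ a → k ≠ b → y d k = p k := fun d k h1 h2 => by
    simp only [y]
    rw [Function.update_of_ne h2, Function.update_of_ne h1]
  have hyq : ∀ d k, k ≠ a → y d k = q d k := fun d k hk => by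
    by_cases hkb : k = b
    · subst hkb
      rw [hyb, hxq]
    · rw [hyp d k hk hkb, hqp d k hkb]
  have hd : F.diag a b ∈ T (y d) := F.diag_mem hT hz (hza.trans (hya d).symm) (hzb.trans (hyb d).symm)
  have hc : F.diag a b ∈ T (y c) := F.diag_mem hT (hx c a b hab) (hya c).symm (hyb c).symm
  have h1 : {e c} ∈ (T (y c)).map (F.col a) := by
    rw [F.map_col_eq hT (hyq c)]
    exact hqc c
  have h2 : {e c} ∈ (T (y c)).map (F.col b) := by
    refine Ultrafilter.mem_map.2 ?_
    filter_upwards [Ultrafilter.mem_map.1 h1, hc] with s hs hs'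
    rw [Set.mem_preimage, ← F.col_diag hab hs']
    exact hs
  have h3 : {e c} ∈ (T (y d)).map (F.col b) := by
    rwa [← F.map_col_eq hT (p := y c) fun k hk => ?_]
    by_cases hka : k = a
    · subst hka
      rw [hya, hya]
    · rw [hyp c k hka hk, hyp d k hka hk]
  have h4 : {e c} ∈ (T (y d)).map (F.col a) := by
    refine Ultrafilter.mem_map.2 ?_
    filter_upwards [Ultrafilter.mem_map.1 h3, hd] with s hs hs'
    rw [Set.mem_preimage, F.col_diag hab hs']
    exact hs
  rw [F.map_col_eq hT (hyq d)] at h4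
  obtain ⟨s, hs, hs'⟩ := Ultrafilter.nonempty_of_mem
    (Filter.inter_mem (Ultrafilter.mem_map.1 h4) (hqc d))
  exact hcd (he ((Set.mem_singleton_iff.1 hs).symm.trans hs'))

/-- There is no representation if the colours can be divided into finitely many classes such that
the facets of an injective tuple do not all have colours in the same class. -/
theorem not_isRealisation (F : FacetColouring E C) (hn : 3 ≤ n) [∀ i, Nonempty (U i)]
    {Q : Type*} [Finite Q] (cls : C → Q)
    (hcls : ∀ s, (∀ i j, i ≠ j → s ∉ F.diag i j) → ∃ i j, cls (F.col i s) ≠ cls (F.col j s))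
    {J : Type v} [Infinite J] {e : J → C} (he : Function.Injective e)
    (hJ : ∀ s, (∀ i j, i ≠ j → s ∉ F.diag i j) → ∀ i j, i ≠ j → ∀ c,
      ∃ y, F.col i y = e c ∧ E j y s) : ¬ IsRealisation E T := by
  intro hT
  obtain ⟨x, hx, hxx⟩ := F.exists_constant_family hn hT he hJ
  have hχ : ∀ i p, ∃ a, (T p).map (fun s => cls (F.col i s)) = pure a := fun i p =>
    Ultrafilter.eq_pure_of_finite _
  choose χ hχ using hχ
  have hχ' : ∀ i p, ∀ᶠ s in (T p : Filter M), cls (F.col i s) = χ i p := fun i p => by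
    have : {χ i p} ∈ (T p).map (fun s => cls (F.col i s)) := by
      rw [hχ]
      exact Set.mem_singleton _
    exact this
  have hpure : Function.Injective (pure : Q → Ultrafilter Q) := Ultrafilter.pure_injective
  have hoff : ∀ i p q, (∀ j, j ≠ i → p j = q j) → χ i p = χ i q := fun i p q h => by
    refine hpure ?_
    rw [← hχ, ← hχ]
    have := congrArg (Ultrafilter.map cls) (F.map_col_eq hT h)
    rwa [Ultrafilter.map_map, Ultrafilter.map_map] at this
  have hdiag : ∀ i j p, i ≠ j → F.diag i j ∈ T p → χ i p = χ j p := fun i j p hij hp => by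
    obtain ⟨s, ⟨h1, h2⟩, h3⟩ := (((hχ' i p).and (hχ' j p)).and hp).exists
    rw [← h1, ← h2, F.col_diag hij h3]
  let pt : (Fin n → J) → ∀ i, U i := fun κ i => x (κ i) i
  obtain ⟨m, rfl⟩ : ∃ m, n = m + 1 := ⟨n - 1, by omega⟩
  -- The class of a facet depends only on the sequence of constants in it, not on the omitted
  -- position.
  have hshift : ∀ (i : Fin (m + 1)) (κ κ' : Fin (m + 1) → J),
      κ ∘ i.succAbove = κ' ∘ (Fin.last m).succAbove → χ i (pt κ) = χ (Fin.last m) (pt κ') := by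
    intro i
    induction i using Fin.reverseInduction with
    | last =>
      intro κ κ' h
      refine hoff _ _ _ fun j hj => ?_
      obtain ⟨k, rfl⟩ := Fin.exists_succAbove_eq hj
      have := congrFun h k
      simp only [Function.comp] at this
      simp only [pt, this]
    | cast i ih =>
      intro κ κ' h
      -- The omitted entry is free, so it may repeat the next one; the diagonal then moves the
      -- omitted position from `i` to `i + 1`, with the remaining sequence unchanged.
      let κ₁ := Function.update κ i.castSucc (κ i.succ)
      have hne : i.castSucc ≠ i.succ := i.castSucc_lt_succ.ne
      have h1 : χ i.castSucc (pt κ) = χ i.castSucc (pt κ₁) := hoff _ _ _ fun j hj => by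
        simp only [pt, κ₁]
        rw [Function.update_of_ne hj]
      have h2 : F.diag i.castSucc i.succ ∈ T (pt κ₁) := by
        refine F.diag_mem hT (hx (κ i.succ) _ _ hne) ?_ ?_
        · simp only [pt, κ₁]
          rw [Function.update_self]
        · simp only [pt, κ₁]
          rw [Function.update_of_ne hne.symm]
      rw [h1, hdiag _ _ _ hne h2]
      refine ih κ₁ κ' (Eq.trans ?_ h)
      funext j
      simp only [Function.comp, κ₁]
      rcases lt_trichotomy j i with hji | hji | hji
      · rw [Fin.succAbove_of_castSucc_lt _ _ (Fin.castSucc_lt_succ_iff.2 hji.le),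
          Fin.succAbove_of_castSucc_lt _ _ (Fin.castSucc_lt_castSucc_iff.2 hji),
          Function.update_of_ne (fun e => hji.ne (Fin.castSucc_injective _ e))]
      · subst hji
        rw [Fin.succAbove_of_castSucc_lt _ _ (Fin.castSucc_lt_succ_iff.2 le_rfl),
          Fin.succAbove_of_le_castSucc _ _ le_rfl, Function.update_self]
      · rw [Fin.succAbove_of_le_castSucc _ _ (Fin.succ_le_castSucc_iff.2 hji),
          Fin.succAbove_of_le_castSucc _ _ (Fin.castSucc_le_castSucc_iff.2 hji.le),
          Function.update_of_ne]
        intro e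
        have := congrArg Fin.val e
        simp only [Fin.val_succ, Fin.val_castSucc] at this
        have := Fin.lt_def.1 hji
        omega
  obtain ⟨D, hD⟩ : ∃ D : Ultrafilter J, ∀ c, ∀ᶠ c' in (D : Filter J), c' ≠ c :=
    ⟨Filter.hyperfilter J, fun c => by
      have := (Set.finite_singleton c).compl_mem_hyperfilter
      exact this⟩
  obtain ⟨j₀⟩ : Nonempty J := inferInstance
  -- The filler `j₀` is irrelevant: the facet opposite the last entry ignores it.
  let ψ : (Fin m → J) → Q := fun t => χ (Fin.last m) (pt (Fin.snoc t j₀))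
  obtain ⟨a, ha⟩ := Ultrafilter.eq_pure_of_finite ((iterUltrafilter D m).map ψ)
  have ha' : ∀ᶠ t in (iterUltrafilter D m : Filter (Fin m → J)), ψ t = a := by
    have : {a} ∈ (iterUltrafilter D m).map ψ := by
      rw [ha]
      exact Set.mem_singleton _
    exact this
  have hall : ∀ᶠ κ in (iterUltrafilter D (m + 1) : Filter (Fin (m + 1) → J)),
      ∀ i : Fin (m + 1), ψ (κ ∘ i.succAbove) = a :=
    Filter.eventually_all.2 fun i => eventually_iter_comp_succAbove i ha'
  obtain ⟨κ, hκ, hinj⟩ := (hall.and (eventually_iter_injective hD (m + 1))).exists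
  have hnd : ∀ᶠ s in (T (pt κ) : Filter M), ∀ i j, i ≠ j → s ∉ F.diag i j := by
    simp only [Filter.eventually_all]
    intro i j hij
    exact Ultrafilter.compl_mem_iff_notMem.2 fun hmem =>
      hxx _ _ (fun e => hij (hinj e)) i j hij ⟨pt κ, rfl, rfl, hmem⟩
  obtain ⟨s, hs, hs'⟩ := (hnd.and (Filter.eventually_all.2 fun i => hχ' i (pt κ))).exists
  obtain ⟨i, j, hij⟩ := hcls s hs
  have hχa : ∀ i, χ i (pt κ) = a := fun i => by
    rw [← hκ i]
    refine hshift i κ _ ?_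
    funext k
    simp
  exact hij (by rw [hs', hs', hχa, hχa])

end FacetColouring

/-! ### Ultrafilters obtained from a representation -/

section Necessity

variable {n : ℕ} {L : Signature n} {M : Type u}

/-- The relation that interprets `c_i`. -/
def cylRel (hDf : LDf n ≤ L) (M : Type u) [L.atomLang.Structure M] (i : Fin n) (x s : M) : Prop :=
  Structure.RelMap (Signature.R (L := L) (.cyl i) (hDf 1 (a := .cyl i) trivial) id) ![x, s]

theorem complexOp_eq (hDf : LDf n ≤ L) [L.atomLang.Structure M] (i : Fin n)
    (x : Fin 1 → Set M) :
    complexOp (Signature.R (L := L) (.cyl i) (hDf 1 (a := .cyl i) trivial) id) x =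
      {s | ∃ y ∈ x 0, cylRel hDf M i y s} := by
  have key : ∀ (y : Fin 1 → M) (s : M), (Fin.snoc y s : Fin 2 → M) = ![y 0, s] := fun y s => by
    funext j
    fin_cases j <;> rfl
  ext s
  constructor
  · rintro ⟨y, hy, hr⟩
    refine ⟨y 0, hy 0, ?_⟩
    rw [key] at hr
    exact hr
  · rintro ⟨y, hy, hr⟩
    refine ⟨fun _ => y, fun i => ?_, ?_⟩
    · rwa [Subsingleton.elim i 0]
    · rw [key]
      exact hr

/-- A boolean homomorphism between power sets induces ultrafilters. -/
theorem exists_ultrafilter_of_hom {P : Type v} (φ : Set M → Set P) (h0 : φ ∅ = ∅)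
    (hc : ∀ Y, φ Yᶜ = (φ Y)ᶜ) (hu : ∀ Y Z, φ (Y ∪ Z) = φ Y ∪ φ Z) :
    ∃ T : P → Ultrafilter M, ∀ p Y, Y ∈ T p ↔ p ∈ φ Y := by
  have hmono : ∀ {Y Z}, Y ⊆ Z → φ Y ⊆ φ Z := fun {Y Z} h => by
    rw [← Set.union_eq_self_of_subset_left h, hu]
    exact Set.subset_union_left
  have hinter : ∀ Y Z, φ (Y ∩ Z) = φ Y ∩ φ Z := fun Y Z => by
    rw [← compl_compl (Y ∩ Z), hc, Set.compl_inter, hu, hc, hc, Set.compl_union, compl_compl,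
      compl_compl]
  let F : P → Filter M := fun p =>
    { sets := {Y | p ∈ φ Y}
      univ_sets := by
        change p ∈ φ Set.univ
        rw [← Set.compl_empty, hc, h0, Set.compl_empty]
        trivial
      sets_of_superset := fun h1 h2 => hmono h2 h1
      inter_sets := fun {Y Z} h1 h2 => by
        change p ∈ φ (Y ∩ Z)
        rw [hinter]
        exact ⟨h1, h2⟩ }
  refine ⟨fun p => Ultrafilter.ofComplNotMemIff (F p) fun Y => ?_, fun p Y => Iff.rfl⟩
  change ¬ p ∈ φ Yᶜ ↔ p ∈ φ Y
  rw [hc]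
  exact not_not

/-- A single factor suffices, because only its boolean operations and cylindrifications are used.
Some factor exists since `M` is nonempty and the algebra therefore nontrivial. -/
theorem exists_isRealisation (hDf : LDf n ≤ L) [L.atomLang.Structure M] [Nonempty M]
    (h : IsStronglyRepresentable L M) :
    ∃ (U : Fin n → Type u) (T : (∀ i, U i) → Ultrafilter M), (∀ i, Nonempty (U i)) ∧
      FacetColouring.IsRealisation (cylRel hDf M) T := by
  have key : ∀ (U : Fin n → Type u) (φ : Set M → Set (∀ i, U i)), φ ∅ = ∅ →
      (∀ Y, φ Yᶜ = (φ Y)ᶜ) → (∀ Y Z, φ (Y ∪ Z) = φ Y ∪ φ Z) →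
      (∀ i Y, φ {s | ∃ y ∈ Y, cylRel hDf M i y s} = {x | ∃ y ∈ φ Y, ∀ j, j ≠ i → y j = x j}) →
      ∃ T : (∀ i, U i) → Ultrafilter M, FacetColouring.IsRealisation (cylRel hDf M) T := by
    intro U φ h0 hc hu hcyl
    obtain ⟨T, hT⟩ := exists_ultrafilter_of_hom φ h0 hc hu
    refine ⟨T, fun i Y p => ?_⟩
    rw [hT, hcyl]
    simp only [hT]
    rfl
  have hne : (∅ : Set M) ≠ Set.univ := Set.empty_ne_univ
  have hz : PEAFunc.zero ∈ L 0 := hDf 0 (a := .zero) trivial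
  have hneg : PEAFunc.neg ∈ L 1 := hDf 1 (a := .neg) trivial
  have hadd : PEAFunc.add ∈ L 2 := hDf 2 (a := .add) trivial
  have hcyl : ∀ i, PEAFunc.cyl i ∈ L 1 := fun i => hDf 1 (a := .cyl i) trivial
  rcases h with ⟨hL, I, U, hU, ⟨f⟩⟩ | ⟨hL, I, U, hU, ⟨f⟩⟩
  · obtain ⟨t⟩ : Nonempty I := by
      by_contra hI
      rw [not_nonempty_iff] at hI
      exact hne (f.injective (funext fun t => isEmptyElim t))
    obtain ⟨T, hT⟩ := key (U t) (fun Y => f Y t)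
      (congrFun (f.map_fun (⟨_, hz⟩ : L.lang.Functions 0) ![]) t)
      (fun Y => congrFun (f.map_fun (⟨_, hneg⟩ : L.lang.Functions 1) ![Y]) t)
      (fun Y Z => congrFun (f.map_fun (⟨_, hadd⟩ : L.lang.Functions 2) ![Y, Z]) t)
      (fun i Y => (congrArg (fun Z => f Z t) (complexOp_eq hDf i ![Y]).symm).trans
        (congrFun (f.map_fun (⟨_, hcyl i⟩ : L.lang.Functions 1) ![Y]) t))
    exact ⟨U t, T, hU t, hT⟩
  · obtain ⟨t⟩ : Nonempty I := by
      by_contra hI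
      rw [not_nonempty_iff] at hI
      exact hne (f.injective (funext fun t => isEmptyElim t))
    obtain ⟨T, hT⟩ := key (fun _ => U t) (fun Y => f Y t)
      (congrFun (f.map_fun (⟨_, hz⟩ : L.lang.Functions 0) ![]) t)
      (fun Y => congrFun (f.map_fun (⟨_, hneg⟩ : L.lang.Functions 1) ![Y]) t)
      (fun Y Z => congrFun (f.map_fun (⟨_, hadd⟩ : L.lang.Functions 2) ![Y, Z]) t)
      (fun i Y => (congrArg (fun Z => f Z t) (complexOp_eq hDf i ![Y]).symm).trans
        (congrFun (f.map_fun (⟨_, hcyl i⟩ : L.lang.Functions 1) ![Y]) t))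
    exact ⟨fun _ => U t, T, fun _ => hU t, hT⟩

end Necessity

/-! ### Extension properties of patterns -/

section PatternFacts

open Pattern
variable {n : ℕ} {X : Type u} {G : X → X → Prop} {c₀ : Colour n X}

theorem exists_copy_ne (c : Colour n X) : ∃ d : Colour n X, d.2 ≠ c.2 := by
  obtain ⟨a, ha⟩ := exists_ne c.2
  exact ⟨(c.1, a), ha⟩

theorem rel_iff_of_face_eq {s t : Pattern n (Colour n X)} {i j k : Fin n} (hj : j ≠ i) (hk : k ≠ i)
    (h : face i s = face i t) : s.rel j k ↔ t.rel j k := by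
  have := congrFun (congrFun (congrArg Prod.fst h) j) k
  simpa [face, hj, hk] using this

theorem Pattern.Valid.col_eq_of_rel {s : Pattern n (Colour n X)} (hs : s.Valid (colourAdj G) c₀)
    {i j : Fin n} (h : s.rel i j) : s.col {i}ᶜ = s.col {j}ᶜ := by
  refine hs.col_congr _ _ ?_
  rw [classes_eq_iff]
  have key : ∀ {i j : Fin n}, s.rel i j → ∀ b ∈ ({i}ᶜ : Finset (Fin n)),
      ∃ b' ∈ ({j}ᶜ : Finset (Fin n)), s.rel b b' := by
    intro i j h b hb
    by_cases hbj : b = j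
    · refine ⟨i, ?_, hbj ▸ s.rel.symm h⟩
      simp only [Finset.mem_compl, Finset.mem_singleton] at hb ⊢
      exact fun e => hb (hbj.trans e.symm)
    · exact ⟨b, by simpa using hbj, s.rel.refl b⟩
  refine ⟨key h, fun b hb => ?_⟩
  obtain ⟨b', hb', e⟩ := key (s.rel.symm h) b hb
  exact ⟨b', hb', s.rel.symm e⟩

/-- The `i`-th entry of a tuple can be changed to a new point. -/
theorem Pattern.Valid.exists_fresh (hn : 3 ≤ n) {s : Pattern n (Colour n X)}
    (hs : s.Valid (colourAdj G) c₀) (i : Fin n) :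
    ∃ t : Pattern n (Colour n X), t.Valid (colourAdj G) c₀ ∧ (∀ j, j ≠ i → ¬ t.rel i j) ∧
      face i t = face i s := by
  obtain ⟨d, hd⟩ := exists_copy_ne (s.col {i}ᶜ)
  obtain ⟨V, g, o, hg, ho⟩ : ∃ (V : Type) (g : Fin n → V) (o : V), Setoid.ker g = s.rel ∧
      ∀ k, g k ≠ o := by
    refine ⟨Option (Quotient s.rel), fun k => some (Quotient.mk _ k), none, ?_, by simp⟩
    ext j k
    rw [Setoid.ker_def, Option.some_inj]
    exact Quotient.eq
  let v : Fin n → V := Function.update g i o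
  have hvi : v i = o := Function.update_self ..
  have hv : ∀ k, k ≠ i → v k = g k := fun k hk => Function.update_of_ne hk ..
  -- Facets through the new point `o` get a colour in a different copy from the facet opposite it,
  -- which provides the adjacent pair.
  let col : Finset V → Colour n X := fun A => if o ∈ A then d else s.col {i}ᶜ
  have hempty : o ∉ ({i}ᶜ : Finset (Fin n)).image v := by
    intro h
    obtain ⟨k, hk, e⟩ := Finset.mem_image.1 h
    exact ho k ((hv k (by simpa using hk)).symm.trans e)
  have hcard : (({i}ᶜ : Finset (Fin n)).image v).card = (classes s.rel {i}ᶜ).card := by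
    have : (classes s.rel {i}ᶜ).card = (({i}ᶜ : Finset (Fin n)).image g).card := by
      rw [← card_classes_ker, hg]
    rw [this]
    exact congrArg Finset.card (Finset.image_congr fun k hk => hv k (by simpa using hk))
  refine ⟨Pattern.ofTuple c₀ v col, Valid.ofTuple fun _ => ?_, fun j hj h => ?_, Prod.ext ?_ ?_⟩
  · have : Nontrivial (Fin n) := Fin.nontrivial_iff_two_le.2 (by omega)
    obtain ⟨j, hj⟩ := exists_ne i
    refine ⟨i, j, Or.inl ?_⟩
    have hj' : o ∈ ({j}ᶜ : Finset (Fin n)).image v :=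
      Finset.mem_image.2 ⟨i, by simpa using hj.symm, hvi⟩
    simp only [col, if_pos hj', if_neg hempty]
    exact hd.symm
  · have : v i = v j := h
    exact ho j ((hv j hj).symm.trans (this.symm.trans hvi))
  · funext j k
    refine propext (and_congr_right fun hj => and_congr_right fun hk => ?_)
    change v j = v k ↔ _
    rw [hv j hj, hv k hk, ← hg]
    rfl
  · change (if _ then _ else _) = s.col {i}ᶜ
    by_cases hc : (({i}ᶜ : Finset (Fin n)).image v).card = n - 1
    · rw [if_pos hc]
      exact if_neg hempty
    · rw [if_neg hc, hs.col_of_card]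
      rwa [hcard] at hc

/-- The `j`-th entry of an injective tuple can be changed so that the facet opposite to the `i`-th
entry has a given colour. -/
theorem exists_facet_colour (hn : 3 ≤ n) {s : Pattern n (Colour n X)} (hs : s.rel = ⊥)
    {i j : Fin n} (hij : i ≠ j) (c : Colour n X) :
    ∃ t : Pattern n (Colour n X), t.Valid (colourAdj G) c₀ ∧ t.col {i}ᶜ = c ∧
      face j t = face j s := by
  obtain ⟨d, hd⟩ := exists_copy_ne c
  obtain ⟨k, hk⟩ : ∃ k : Fin n, k ∉ ({i, j} : Finset (Fin n)) := by
    by_contra hcon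
    push Not at hcon
    have := Finset.card_le_card (Finset.subset_iff.2 fun k (_ : k ∈ Finset.univ) => hcon k)
    rw [Finset.card_univ, Fintype.card_fin] at this
    have := Finset.card_le_two (a := i) (b := j)
    omega
  rw [Finset.mem_insert, Finset.mem_singleton, not_or] at hk
  -- The facet opposite `i` gets `c`, the one opposite `j` is kept, and all others get `d`. The
  -- facet opposite the third index `k` is then adjacent to that opposite `i`, whatever the kept
  -- colour is.
  let col : Finset (Fin n) → Colour n X := fun A =>
    if j ∈ A then if i ∈ A then d else c else s.col {j}ᶜ
  have hcol : ∀ k, (ofTuple c₀ id col).col {k}ᶜ = col {k}ᶜ := fun k => by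
    simp [ofTuple, card_compl_singleton]
  have hi : col {i}ᶜ = c := by simp [col, hij.symm]
  refine ⟨ofTuple c₀ id col, Valid.ofTuple fun _ => ⟨i, k, Or.inl ?_⟩, (hcol i).trans hi,
    Prod.ext ?_ ?_⟩
  · have himg : ∀ B : Finset (Fin n),
        @Finset.image _ _ (fun a b => Classical.propDecidable (a = b)) id B = B := fun B => by
      ext
      simp
    rw [himg, himg, hi]
    have : col {k}ᶜ = d := by simp [col, Ne.symm hk.1, Ne.symm hk.2]
    rw [this]
    exact hd.symm
  · funext a b
    refine propext (and_congr_right fun ha => and_congr_right fun hb => ?_)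
    rw [hs]
    rfl
  · refine (hcol j).trans ?_
    simp [col, face]

end PatternFacts

/-! ### The ultraproduct and its failure to be representable -/

section Ultraproduct

open Pattern Filter

variable {n : ℕ} {L : Signature n} {X : Type u} {G : ℕ → X → X → Prop} {c₀ : Colour n X}
  {u : Ultrafilter ℕ}

theorem nonempty_patternAtom (hn : 3 ≤ n) (G : X → X → Prop) (c₀ : Colour n X) :
    Nonempty (PatternAtom G c₀) :=
  ⟨⟨ofTuple c₀ (fun _ : Fin n => ()) fun _ => c₀, Valid.ofTuple fun h => by
    have := Fintype.card_le_of_injective _ h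
    simp at this
    omega⟩⟩

/-- The ultraproduct of the atom structures of the patterns for a sequence of graphs. -/
abbrev PatternProduct (u : Ultrafilter ℕ) (G : ℕ → X → X → Prop) (c₀ : Colour n X) : Type u :=
  (u : Filter ℕ).Product fun m => PatternAtom (G m) c₀

/-- The element of the ultraproduct given by a sequence of atoms. -/
def PatternProduct.mk (u : Ultrafilter ℕ) (f : ∀ m, PatternAtom (G m) c₀) :
    PatternProduct u G c₀ :=
  Quotient.mk ((u : Filter ℕ).productSetoid fun m => PatternAtom (G m) c₀) f

theorem PatternProduct.exists_mk (x : PatternProduct u G c₀) : ∃ f, PatternProduct.mk u f = x :=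
  Quotient.exists_rep x

theorem cylRel_mk (hDf : LDf n ≤ L) (i : Fin n) (f g : ∀ m, PatternAtom (G m) c₀) :
    cylRel hDf (PatternProduct u G c₀) i (PatternProduct.mk u f) (PatternProduct.mk u g) ↔
      ∀ᶠ m in (u : Filter ℕ), face i (f m).1 = face i (g m).1 := by
  have h : (![PatternProduct.mk u f, PatternProduct.mk u g] : Fin 2 → PatternProduct u G c₀) =
      fun j => PatternProduct.mk u ((![f, g] : Fin 2 → ∀ m, PatternAtom (G m) c₀) j) := by
    funext j
    fin_cases j <;> rfl
  rw [cylRel, h]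
  exact relMap_quotient_mk' (s := (u : Filter ℕ).productSetoid fun m => PatternAtom (G m) c₀)
    (ps := Ultraproduct.setoidPrestructure (fun m => PatternAtom (G m) c₀) u) _ _

/-- The diagonals of the ultraproduct. -/
def productDiag (u : Ultrafilter ℕ) (G : ℕ → X → X → Prop) (c₀ : Colour n X) (i j : Fin n) :
    Set (PatternProduct u G c₀) :=
  {x | Quotient.liftOn x (fun f => ∀ᶠ m in (u : Filter ℕ), (f m).1.rel i j) fun f g h =>
    propext (eventually_congr (by filter_upwards [h] with m hm; rw [hm]))}

/-- The colours of the facets in the ultraproduct. -/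
def productCol (i : Fin n) (x : PatternProduct u G c₀) : Germ (u : Filter ℕ) (Colour n X) :=
  Quotient.liftOn x (fun f => ((fun m => (f m).1.col {i}ᶜ : ℕ → Colour n X) : Germ _ _)) fun f g h =>
    Germ.coe_eq.2 (by filter_upwards [h] with m hm; rw [hm])

theorem mk_mem_productDiag {i j : Fin n} {f : ∀ m, PatternAtom (G m) c₀} :
    PatternProduct.mk u f ∈ productDiag u G c₀ i j ↔
      ∀ᶠ m in (u : Filter ℕ), (f m).1.rel i j := Iff.rfl

/-- The diagonals and the colours of the ultraproduct. -/
def productColouring (hn : 3 ≤ n) (hDf : LDf n ≤ L) (u : Ultrafilter ℕ) (G : ℕ → X → X → Prop)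
    (c₀ : Colour n X) : FacetColouring (cylRel hDf (PatternProduct u G c₀))
      (Germ (u : Filter ℕ) (Colour n X)) where
  diag := productDiag u G c₀
  col := productCol
  diag_symm := by
    intro i j s h
    obtain ⟨f, rfl⟩ := s.exists_mk
    filter_upwards [mk_mem_productDiag.1 h] with m hm using (f m).1.rel.symm hm
  diag_trans := by
    intro i j k s h h'
    obtain ⟨f, rfl⟩ := s.exists_mk
    filter_upwards [mk_mem_productDiag.1 h, mk_mem_productDiag.1 h'] with m hm hm'
      using (f m).1.rel.trans hm hm'
  diag_iff := by
    intro i j k x s hi hj h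
    obtain ⟨f, rfl⟩ := x.exists_mk
    obtain ⟨g, rfl⟩ := s.exists_mk
    rw [mk_mem_productDiag, mk_mem_productDiag]
    refine eventually_congr ?_
    filter_upwards [(cylRel_mk hDf k f g).1 h] with m hm
    exact rel_iff_of_face_eq hi.symm hj.symm hm
  exists_diag := by
    intro i j hij s
    obtain ⟨f, rfl⟩ := s.exists_mk
    refine ⟨PatternProduct.mk u fun m => ⟨(f m).1.subst (repl i j), (f m).2.subst _⟩, ?_, ?_⟩
    · refine mk_mem_productDiag.2 (Eventually.of_forall fun m => ?_)
      change (f m).1.rel (repl i j i) (repl i j j)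
      rw [repl_self, repl_of_ne hij.symm]
    · exact (cylRel_mk hDf i _ _).2 (Eventually.of_forall fun m => face_subst_repl _ _ _)
  exists_fresh := by
    intro i s
    obtain ⟨f, rfl⟩ := s.exists_mk
    choose t ht htr htf using fun m => (f m).2.exists_fresh hn i
    refine ⟨PatternProduct.mk u fun m => ⟨t m, ht m⟩, fun j hj h => ?_, ?_⟩
    · obtain ⟨m, hm⟩ := (mk_mem_productDiag.1 h).exists
      exact htr m j hj hm
    · exact (cylRel_mk hDf i _ _).2 (Eventually.of_forall htf)
  col_eq := by
    intro i x s h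
    obtain ⟨f, rfl⟩ := x.exists_mk
    obtain ⟨g, rfl⟩ := s.exists_mk
    refine Germ.coe_eq.2 ?_
    filter_upwards [(cylRel_mk hDf i f g).1 h] with m hm using congrArg Prod.snd hm
  col_diag := by
    intro i j s _ h
    obtain ⟨f, rfl⟩ := s.exists_mk
    refine Germ.coe_eq.2 ?_
    filter_upwards [mk_mem_productDiag.1 h] with m hm using (f m).2.col_eq_of_rel hm

theorem eventually_rel_eq_bot {f : ∀ m, PatternAtom (G m) c₀}
    (h : ∀ i j, i ≠ j → PatternProduct.mk u f ∉ productDiag u G c₀ i j) :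
    ∀ᶠ m in (u : Filter ℕ), (f m).1.rel = ⊥ := by
  have : ∀ᶠ m in (u : Filter ℕ), ∀ i j, i ≠ j → ¬ (f m).1.rel i j := by
    simp only [eventually_all]
    exact fun i j hij => Ultrafilter.eventually_not.2 fun hm => h i j hij (mk_mem_productDiag.2 hm)
  filter_upwards [this] with m hm
  refine eq_bot_iff.2 fun a b hab => ?_
  by_contra hne
  exact hm a b hne hab

/-- The ultraproduct is not strongly representable if the ultraproduct of the graphs is finitely
colourable. -/
theorem not_isStronglyRepresentable_product (hn : 3 ≤ n) (hDf : LDf n ≤ L) [Infinite X]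
    {Q : Type*} [Finite Q] (χ : (ℕ → X) → Q)
    (hχ : ∀ x y : ℕ → X, (∀ᶠ m in (u : Filter ℕ), G m (x m) (y m)) → χ x ≠ χ y) :
    ¬ IsStronglyRepresentable L (PatternProduct u G c₀) := by
  intro hrep
  have hne : ∀ m, Nonempty (PatternAtom (G m) c₀) := fun m => nonempty_patternAtom hn (G m) c₀
  have hM : Nonempty (PatternProduct u G c₀) := ⟨PatternProduct.mk u fun m => (hne m).some⟩
  obtain ⟨U, T, hU, hT⟩ := exists_isRealisation hDf hrep
  -- `χ` is defined on sequences and need not respect germs, so representatives are fixed.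
  choose ρ hρ using fun c : Germ (u : Filter ℕ) (Colour n X) => Quotient.exists_rep c
  have hρ' : ∀ f : ℕ → Colour n X,
      ∀ᶠ m in (u : Filter ℕ), ρ (f : Germ (u : Filter ℕ) (Colour n X)) m = f m := fun f =>
    Germ.coe_eq.1 (hρ (f : Germ (u : Filter ℕ) (Colour n X)))
  have hcopy : ∀ c, ∃ a, ∀ᶠ m in (u : Filter ℕ), (ρ c m).2 = a := fun c => exists_copy (u.map (ρ c))
  choose κ hκ using hcopy
  -- The class of a germ of colours is its limiting copy with the `χ`-colour of its vertices. The
  -- infinite family consists of the constant germs.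
  refine (productColouring hn hDf u G c₀).not_isRealisation hn
    (fun c => (κ c, χ fun m => (ρ c m).1)) ?_ (J := Colour n X)
    (e := fun c => ((fun _ => c : ℕ → Colour n X) : Germ (u : Filter ℕ) (Colour n X))) ?_ ?_ hT
  · intro s hs
    obtain ⟨f, rfl⟩ := s.exists_mk
    have hadj : ∀ᶠ m in (u : Filter ℕ), ∃ i j,
        colourAdj (G m) ((f m).1.col {i}ᶜ) ((f m).1.col {j}ᶜ) := by
      filter_upwards [eventually_rel_eq_bot hs] with m hm using (f m).2.adj hm
    -- There are finitely many pairs of facets, so one pair is adjacent for almost all `m`.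
    simp only [Ultrafilter.eventually_exists_iff] at hadj
    obtain ⟨i, j, hij⟩ := hadj
    refine ⟨i, j, fun heq => ?_⟩
    obtain ⟨h1, h2⟩ := Prod.ext_iff.1 heq
    refine hχ _ _ ?_ h2
    filter_upwards [hij, hρ' fun m => (f m).1.col {i}ᶜ, hρ' fun m => (f m).1.col {j}ᶜ,
      hκ ((fun m => (f m).1.col {i}ᶜ : ℕ → Colour n X) : Germ (u : Filter ℕ) (Colour n X)),
      hκ ((fun m => (f m).1.col {j}ᶜ : ℕ → Colour n X) : Germ (u : Filter ℕ) (Colour n X))]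
      with m hm hi hj hki hkj
    change _ = _ at h1
    rw [← hi, ← hj] at hm
    exact hm.resolve_left fun hne => hne (hki.trans (h1.trans hkj.symm))
  · intro c d h
    obtain ⟨m, hm⟩ := (Germ.coe_eq.1 h).exists
    exact hm
  · intro s hs i j hij c
    obtain ⟨f, rfl⟩ := s.exists_mk
    have hbot := eventually_rel_eq_bot hs
    have hex : ∀ m, ∃ t : PatternAtom (G m) c₀, (f m).1.rel = ⊥ →
        t.1.col {i}ᶜ = c ∧ face j t.1 = face j (f m).1 := fun m => by
      by_cases hm : (f m).1.rel = ⊥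
      · obtain ⟨t, ht, h⟩ := exists_facet_colour (G := G m) (c₀ := c₀) hn hm hij c
        exact ⟨⟨t, ht⟩, fun _ => h⟩
      · exact ⟨f m, fun h => absurd h hm⟩
    choose t ht using hex
    refine ⟨PatternProduct.mk u t, Germ.coe_eq.2 ?_, (cylRel_mk hDf j t f).2 ?_⟩
    · filter_upwards [hbot] with m hm using (ht m hm).1
    · filter_upwards [hbot] with m hm using (ht m hm).2

end Ultraproduct

/-! ### Application to the shift graphs -/

theorem infinite_incSeq : Infinite IncSeq :=
  Infinite.of_injective (fun k : ℕ => (⟨fun j => k + j, fun a b h => by simpa using h⟩ : IncSeq))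
    fun a b h => by simpa using congrFun (congrArg Subtype.val h) 0

theorem infiniteChromatic_shiftRel (m : ℕ) :
    InfiniteChromatic fun x y : ULift.{u} IncSeq => shiftRel m x.down y.down := by
  intro α _ f
  obtain ⟨x, y, hxy, h⟩ := exists_shiftRel_eq m fun x => f ⟨x⟩
  exact ⟨⟨x⟩, ⟨y⟩, hxy, h⟩

/-- The ultraproduct of the shift graphs with growing windows has a colouring by two colours. -/
theorem exists_shift_colouring_product {u : Ultrafilter ℕ} (hu : (u : Filter ℕ) ≤ Filter.atTop) :
    ∃ χ : (ℕ → ULift.{u} IncSeq) → Bool, ∀ x y : ℕ → ULift.{u} IncSeq,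
      (∀ᶠ m in (u : Filter ℕ), shiftRel m (x m).down (y m).down) → χ x ≠ χ y := by
  obtain ⟨χ, hχ⟩ := exists_shift_colouring (Filter.Germ (u : Filter ℕ) ℕ)
  -- Read `x` as a sequence of germs. Each fixed `j` is eventually inside the window, so along an
  -- edge `y` is the exact shift of `x`.
  refine ⟨fun x => χ fun j => ((fun m => (x m).down.1 j : ℕ → ℕ) : Filter.Germ (u : Filter ℕ) ℕ),
    fun x y hxy => hχ _ _ ?_ ?_⟩
  · intro j k h
    obtain ⟨m, hm⟩ := (Filter.Germ.coe_eq.1 h).exists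
    exact (x m).down.2.injective hm
  · intro j
    refine Filter.Germ.coe_eq.2 ?_
    filter_upwards [hxy, hu (Filter.eventually_gt_atTop j)] with m hm hj using hm.2 j hj

end PolyadicAlg

theorem mainTheorem4 (n : ℕ) (hn : 3 ≤ n) (L : PolyadicAlg.Signature n)
    (hDf : PolyadicAlg.LDf n ≤ L) (hPEA : L ≤ PolyadicAlg.LPEA n) :
    ¬ PolyadicAlg.IsElementaryClass.{u} L.atomLang
      (fun S _ => PolyadicAlg.IsStronglyRepresentable L S) := by
  rintro ⟨T, hT⟩
  let X := ULift.{u} PolyadicAlg.IncSeq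
  have hX : Infinite X := by
    have := PolyadicAlg.infinite_incSeq
    infer_instance
  let G : ℕ → X → X → Prop := fun m x y => PolyadicAlg.shiftRel m x.down y.down
  let c₀ : PolyadicAlg.Colour n X := (⟨fun j => j, strictMono_id⟩, none)
  let 𝒰 : Ultrafilter ℕ := Filter.hyperfilter ℕ
  obtain ⟨χ, hχ⟩ := PolyadicAlg.exists_shift_colouring_product.{u} (u := 𝒰)
    Nat.hyperfilter_le_atTop
  have hne : ∀ m, Nonempty (PolyadicAlg.PatternAtom (G m) c₀) := fun m =>
    PolyadicAlg.nonempty_patternAtom hn (G m) c₀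
  refine PolyadicAlg.not_isStronglyRepresentable_product (c₀ := c₀) hn hDf χ hχ
    ((hT (PolyadicAlg.PatternProduct 𝒰 G c₀)).2 ?_)
  refine ⟨fun φ hφ => ?_⟩
  -- Łoś: every factor is strongly representable, hence a model of the theory, and so is the
  -- ultraproduct.
  refine (Ultraproduct.sentence_realize φ).2 (Filter.Eventually.of_forall fun m => ?_)
  have := (hT (PolyadicAlg.PatternAtom (G m) c₀)).1
    (PolyadicAlg.isStronglyRepresentable_patternAtom hn L
      (PolyadicAlg.infiniteChromatic_shiftRel m) c₀)
  exact this.realize_of_mem φ hφ
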